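/- Let $X$ be a connected (Hausdorff, second countable) complex manifold of dimension $n$ with a Hermitian form $\Theta$, i.e. a smooth real $J$-invariant $2$-form such that $g(u,v)=\Theta(u,Jv)$ is a Riemannian metric, and let $\mathrm{dV}=\Theta^n/n!$ be its volume measure (the Riemannian volume of $g$). Let $L$ be a holomorphic line bundle on $X$ with a smooth Hermitian metric $h$. Let $H^0(X,L)$ be the space of holomorphic sections of $L$, with the topology defined by the seminorms $s\mapsto\sup_{K}|s|_h$, $K\subset X$ compact, and with its Borel $\sigma$-algebra. Let $H^0_{(2)}(X,L)$ be the space of those $s\in H^0(X,L)$ with $\int_X|s|_h^2\,\mathrm{dV}<\infty$, with the inner product $\langle s,t\rangle=\int_X\langle s,t\rangle_h\,\mathrm{dV}$, and let $d\in\mathbb N\cup\{\infty\}$ be its dimension. (1) Let $\{S_j\}_{0\le j<d}$ be an orthonormal (Hilbert) basis of $H^0_{(2)}(X,L)$ and let $\{\eta_j\}_{0\le j<d}$ be i.i.d. centered Gaussian random variables, real or complex, on a probability space $(\Omega,\mathbb P)$. Then there is a random variable $\psi$ on $\Omega$ with values in $H^0(X,L)$ such that, almost surely, the partial sums $\sum_{j<N,\,j<d}\eta_jS_j$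 converge to $\psi$ as $N\to\infty$, uniformly on every compact subset of $X$. In other words, the series $\psi^S_\eta=\sum_j\eta_jS_j$ converges almost surely, locally uniformly, to a holomorphic section of $L$. (2) If $S=\{S_j\}$ and $S'=\{S'_j\}$ are two orthonormal bases as in (1), and $\eta=\{\eta_j\}$, $\eta'=\{\eta'_j\}$ are two families of i.i.d. standard complex Gaussian random variables, possibly the same and possibly on different probability spaces, then the random holomorphic sections $\psi^{S}_{\eta}$ and $\psi^{S'}_{\eta'}$ have the same distribution on $H^0(X,L)$. Here a standard complex Gaussian is a random variable with the distribution of $(U+\sqrt{-1}\,V)/\sqrt2$, where $U,V$ are independent standard real Gaussians. -/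

import Mathlib

open Bundle Filter MeasureTheory ProbabilityTheory Set
open scoped Manifold ContDiff Topology ComplexConjugate ENNReal

noncomputable section

namespace GaussSec

/-! ### Hermitian forms on a complex manifold and their volume measure -/

section Base

variable {n : ℕ} {X : Type*} [TopologicalSpace X] [ChartedSpace (EuclideanSpace ℂ (Fin n)) X]

/-- The differential of the inverse of a chart `φ` at the point `z` of its target. It sends
a coordinate vector to the tangent vector of `X` at `φ.symm z` that it represents. -/
def chartVec (φ : OpenPartialHomeomorph X (EuclideanSpace ℂ (Fin n)))
    (z : EuclideanSpace ℂ (Fin n)) :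
    EuclideanSpace ℂ (Fin n) →L[ℂ]
      TangentSpace 𝓘(ℂ, EuclideanSpace ℂ (Fin n)) (φ.symm z) :=
  mfderiv 𝓘(ℂ, EuclideanSpace ℂ (Fin n)) 𝓘(ℂ, EuclideanSpace ℂ (Fin n)) φ.symm z

variable (n X) in
/-- A Hermitian form `Θ` on the complex manifold `X`: a smooth real two-form which is invariant
under the complex structure `J` (multiplication by `Complex.I` on tangent spaces) and positive,
i.e. `g(u, v) = Θ(u, J v)` is a Riemannian metric. -/
structure HermitianForm where
  /-- the two-form on each tangent space -/
  form (x : X) : TangentSpace 𝓘(ℂ, EuclideanSpace ℂ (Fin n)) x →ₗ[ℝ]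
    TangentSpace 𝓘(ℂ, EuclideanSpace ℂ (Fin n)) x →ₗ[ℝ] ℝ
  alternating : ∀ x v, form x v v = 0
  invariant : ∀ x u v, form x (Complex.I • u) (Complex.I • v) = form x u v
  positive : ∀ x v, v ≠ 0 → 0 < form x v (Complex.I • v)
  /-- the coefficients of `Θ` are smooth functions in every chart -/
  smooth : ∀ φ ∈ atlas (EuclideanSpace ℂ (Fin n)) X, ∀ u v : EuclideanSpace ℂ (Fin n),
    ContDiffOn ℝ ∞ (fun z => form (φ.symm z) (chartVec φ z u) (chartVec φ z v)) φ.target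

/-- The real coordinate frame `∂/∂x₁, …, ∂/∂xₙ, ∂/∂y₁, …, ∂/∂yₙ` of `ℂⁿ`, `z = x + i y`. -/
def coordFrame (n : ℕ) : Fin n ⊕ Fin n → EuclideanSpace ℂ (Fin n) :=
  Sum.elim (fun j => EuclideanSpace.single j 1) (fun j => EuclideanSpace.single j Complex.I)

namespace HermitianForm

variable (Θ : HermitianForm n X)

/-- The associated Riemannian metric `g(u, v) = Θ(u, J v)`. -/
def metric (x : X) (u v : TangentSpace 𝓘(ℂ, EuclideanSpace ℂ (Fin n)) x) : ℝ :=
  Θ.form x u (Complex.I • v)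

/-- The density `√(det g)` of the volume form `Θⁿ / n!`, i.e. of the Riemannian volume form of
`g`, with respect to Lebesgue measure in the chart `φ`. -/
def volDensity (φ : OpenPartialHomeomorph X (EuclideanSpace ℂ (Fin n)))
    (z : EuclideanSpace ℂ (Fin n)) : ℝ :=
  Real.sqrt (Matrix.det (Matrix.of fun a b : Fin n ⊕ Fin n =>
    Θ.metric (φ.symm z) (chartVec φ z (coordFrame n a)) (chartVec φ z (coordFrame n b))))

variable [MeasurableSpace X]

/-- The measure `√(det g) dλ` in the domain of the chart `φ`, extended by zero to `X`. -/
def chartVol (φ : OpenPartialHomeomorph X (EuclideanSpace ℂ (Fin n))) : Measure X :=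
  Measure.map φ.symm ((volume.restrict φ.target).withDensity
    fun z => ENNReal.ofReal (Θ.volDensity φ z))

/-- The volume measure `dV = Θⁿ / n!` on `X`. The measures `√(det g) dλ` of the various charts
agree where the charts overlap; `dV` is the measure obtained by gluing them, which is the least
measure dominating all of them. See `vol_restrict_source`. -/
def vol : Measure X :=
  ⨆ φ ∈ atlas (EuclideanSpace ℂ (Fin n)) X, Θ.chartVol φ

variable {Θ} in
lemma contDiffOn_metric {φ : OpenPartialHomeomorph X (EuclideanSpace ℂ (Fin n))}
    (hφ : φ ∈ atlas (EuclideanSpace ℂ (Fin n)) X) (u v : EuclideanSpace ℂ (Fin n)) :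
    ContDiffOn ℝ ∞ (fun z => Θ.metric (φ.symm z) (chartVec φ z u) (chartVec φ z v)) φ.target := by
  refine (Θ.smooth φ hφ u (Complex.I • v)).congr fun z _ => ?_
  rw [metric, (chartVec φ z).map_smul]

lemma continuousOn_volDensity {φ : OpenPartialHomeomorph X (EuclideanSpace ℂ (Fin n))}
    (hφ : φ ∈ atlas (EuclideanSpace ℂ (Fin n)) X) :
    ContinuousOn (Θ.volDensity φ) φ.target := by
  unfold volDensity
  simp only [Matrix.det_apply]
  refine ContinuousOn.sqrt (continuousOn_finsetSum _ fun σ _ => ContinuousOn.const_smul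
    (continuousOn_finsetProd _ fun a _ => ?_) _)
  exact (contDiffOn_metric hφ _ _).continuousOn

lemma measurableSet_chart_image [BorelSpace X]
    {φ : OpenPartialHomeomorph X (EuclideanSpace ℂ (Fin n))}
    {A : Set X} (hA : MeasurableSet A) (hAs : A ⊆ φ.source) : MeasurableSet (φ '' A) := by
  rw [φ.image_eq_target_inter_inv_preimage hAs, ← Subtype.image_preimage_coe]
  have h1 : Measurable (φ.target.domRestrict φ.symm) :=
    (continuousOn_iff_continuous_domRestrict.1 φ.continuousOn_symm).measurable
  exact φ.open_target.measurableSet.subtype_image (h1 hA)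

lemma chartVol_apply [BorelSpace X] {φ : OpenPartialHomeomorph X (EuclideanSpace ℂ (Fin n))}
    {A : Set X} (hA : MeasurableSet A) :
    Θ.chartVol φ A = ∫⁻ z in φ '' (A ∩ φ.source), ENNReal.ofReal (Θ.volDensity φ z) := by
  have hm : AEMeasurable φ.symm (volume.restrict φ.target) :=
    φ.continuousOn_symm.aemeasurable φ.open_target.measurableSet
  have himg : φ '' (A ∩ φ.source) = φ.symm ⁻¹' A ∩ φ.target := by
    rw [φ.image_eq_target_inter_inv_preimage inter_subset_right]
    ext z
    constructor
    · rintro ⟨h1, h2⟩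
      exact ⟨h2.1, h1⟩
    · rintro ⟨h1, h2⟩
      exact ⟨h2, h1, φ.map_target h2⟩
  rw [chartVol, Measure.map_apply_of_aemeasurable
    (hm.mono_ac (withDensity_absolutelyContinuous _ _)) hA, withDensity_apply',
    Measure.restrict_restrict', himg]
  exact φ.open_target.measurableSet

/-- The real coordinate basis. -/
lemma exists_basis (n : ℕ) : ∃ b : Module.Basis (Fin n ⊕ Fin n) ℝ (EuclideanSpace ℂ (Fin n)),
    ⇑b = coordFrame n := by
  let b := (Complex.basisOneI.smulTower (EuclideanSpace.basisFun (Fin n) ℂ).toBasis)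
  let e : Fin 2 × Fin n ≃ Fin n ⊕ Fin n :=
    (Equiv.prodCongrLeft fun _ => finTwoEquiv).trans (Equiv.boolProdEquivSum (Fin n))
  refine ⟨b.reindex e, ?_⟩
  ext1 a
  rcases a with j | j
  · have : finTwoEquiv.symm false = 0 := rfl
    simp [b, e, coordFrame, this]
  · have : finTwoEquiv.symm true = 1 := rfl
    ext i
    simp [b, e, coordFrame, this]

/-- Change of charts for the coefficients of the metric. -/
lemma metric_change [IsManifold 𝓘(ℂ, EuclideanSpace ℂ (Fin n)) ω X]
    {φ ψ : OpenPartialHomeomorph X (EuclideanSpace ℂ (Fin n))}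
    (hφ : φ ∈ atlas (EuclideanSpace ℂ (Fin n)) X) (hψ : ψ ∈ atlas (EuclideanSpace ℂ (Fin n)) X)
    {z : EuclideanSpace ℂ (Fin n)} (hz : z ∈ φ.target) (hz' : φ.symm z ∈ ψ.source) :
    ∃ T : EuclideanSpace ℂ (Fin n) →L[ℂ] EuclideanSpace ℂ (Fin n),
      HasFDerivAt (fun w => ψ (φ.symm w)) T z ∧
      ∀ u v, Θ.metric (φ.symm z) (chartVec φ z u) (chartVec φ z v) =
        Θ.metric (ψ.symm (ψ (φ.symm z))) (chartVec ψ (ψ (φ.symm z)) (T u))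
          (chartVec ψ (ψ (φ.symm z)) (T v)) := by
  have : IsManifold 𝓘(ℂ, EuclideanSpace ℂ (Fin n)) 1 X := .of_le (n := ω) le_top
  have h1 : MDifferentiableAt 𝓘(ℂ, EuclideanSpace ℂ (Fin n)) 𝓘(ℂ, EuclideanSpace ℂ (Fin n))
      φ.symm z := mdifferentiableAt_atlas_symm hφ hz
  have h2 : MDifferentiableAt 𝓘(ℂ, EuclideanSpace ℂ (Fin n)) 𝓘(ℂ, EuclideanSpace ℂ (Fin n))
      ψ (φ.symm z) := mdifferentiableAt_atlas hψ hz'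
  have h3 : MDifferentiableAt 𝓘(ℂ, EuclideanSpace ℂ (Fin n)) 𝓘(ℂ, EuclideanSpace ℂ (Fin n))
      ψ.symm (ψ (φ.symm z)) := mdifferentiableAt_atlas_symm hψ (ψ.map_source hz')
  have h4 := h2.comp z h1
  have hx : ψ.symm (ψ (φ.symm z)) = φ.symm z := ψ.left_inv hz'
  refine ⟨fderiv ℂ (fun w => ψ (φ.symm w)) z, h4.differentiableAt.hasFDerivAt, fun u v => ?_⟩
  have hev : φ.symm =ᶠ[𝓝 z] ψ.symm ∘ (ψ ∘ φ.symm) := by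
    have : φ.symm ⁻¹' ψ.source ∈ 𝓝 z :=
      (φ.continuousAt_symm hz).preimage_mem_nhds (ψ.open_source.mem_nhds hz')
    filter_upwards [this] with w hw
    exact (ψ.left_inv hw).symm
  have key : ∀ u : EuclideanSpace ℂ (Fin n), (chartVec φ z u : EuclideanSpace ℂ (Fin n)) =
      chartVec ψ (ψ (φ.symm z)) (fderiv ℂ (fun w => ψ (φ.symm w)) z u) := fun u => by
    have e1 : (mfderiv 𝓘(ℂ, EuclideanSpace ℂ (Fin n)) 𝓘(ℂ, EuclideanSpace ℂ (Fin n))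
        φ.symm z : EuclideanSpace ℂ (Fin n) →L[ℂ] EuclideanSpace ℂ (Fin n)) =
        mfderiv 𝓘(ℂ, EuclideanSpace ℂ (Fin n)) 𝓘(ℂ, EuclideanSpace ℂ (Fin n))
        (ψ.symm ∘ (ψ ∘ φ.symm)) z := hev.mfderiv_eq
    have e2 := mfderiv_comp z h3 h4
    rw [mfderiv_eq_fderiv] at e2
    exact (DFunLike.congr_fun e1 u).trans (DFunLike.congr_fun e2 u)
  have cast : ∀ x y : X, x = y → ∀ u v u' v' : EuclideanSpace ℂ (Fin n), u = u' → v = v' →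
      Θ.metric x u v = Θ.metric y u' v' := by
    rintro x _ rfl u v _ _ rfl rfl
    rfl
  exact cast _ _ hx.symm _ _ _ _ (key u) (key v)

lemma volDensity_change [IsManifold 𝓘(ℂ, EuclideanSpace ℂ (Fin n)) ω X]
    {φ ψ : OpenPartialHomeomorph X (EuclideanSpace ℂ (Fin n))}
    (hφ : φ ∈ atlas (EuclideanSpace ℂ (Fin n)) X) (hψ : ψ ∈ atlas (EuclideanSpace ℂ (Fin n)) X)
    {z : EuclideanSpace ℂ (Fin n)} (hz : z ∈ φ.target) (hz' : φ.symm z ∈ ψ.source) :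
    ∃ T : EuclideanSpace ℂ (Fin n) →L[ℝ] EuclideanSpace ℂ (Fin n),
      HasFDerivAt (fun w => ψ (φ.symm w)) T z ∧
      Θ.volDensity φ z = |T.det| * Θ.volDensity ψ (ψ (φ.symm z)) := by
  obtain ⟨T, hT, hm⟩ := Θ.metric_change hφ hψ hz hz'
  refine ⟨T.restrictScalars ℝ, hT.restrictScalars ℝ, ?_⟩
  obtain ⟨b, hb⟩ := exists_basis n
  have hsm : ∀ (c : ℝ) (u : EuclideanSpace ℂ (Fin n)), chartVec ψ (ψ (φ.symm z)) (c • u) =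
      c • chartVec ψ (ψ (φ.symm z)) u := fun c u => by
    exact (chartVec ψ (ψ (φ.symm z))).map_smul (c : ℂ) u
  have hsm' : ∀ (c : ℝ) (u : TangentSpace 𝓘(ℂ, EuclideanSpace ℂ (Fin n))
      (ψ.symm (ψ (φ.symm z)))), Complex.I • c • u = c • Complex.I • u := fun c u =>
    smul_comm _ _ _
  let B : LinearMap.BilinForm ℝ (EuclideanSpace ℂ (Fin n)) :=
    LinearMap.mk₂ ℝ (fun u v => Θ.metric (ψ.symm (ψ (φ.symm z))) (chartVec ψ (ψ (φ.symm z)) u)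
      (chartVec ψ (ψ (φ.symm z)) v))
      (fun u u' v => by simp [metric]) (fun c u v => by simp [metric, hsm])
      (fun u v v' => by simp [metric]) (fun c u v => by simp [metric, hsm, hsm'])
  have e1 : Θ.volDensity ψ (ψ (φ.symm z)) = Real.sqrt (LinearMap.BilinForm.toMatrix b B).det := by
    rw [volDensity]
    congr 2
    ext i j
    rw [LinearMap.BilinForm.toMatrix_apply, hb]
    rfl
  have e2 : Θ.volDensity φ z = Real.sqrt (LinearMap.BilinForm.toMatrix b
      (B.comp (T.restrictScalars ℝ : _ →L[ℝ] _).toLinearMap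
        (T.restrictScalars ℝ : _ →L[ℝ] _).toLinearMap)).det := by
    rw [volDensity]
    congr 2
    ext i j
    rw [LinearMap.BilinForm.toMatrix_apply, hb]
    exact hm _ _
  rw [e1, e2, LinearMap.BilinForm.toMatrix_comp b b, Matrix.det_mul, Matrix.det_mul, Matrix.det_transpose,
    LinearMap.det_toMatrix, mul_right_comm, ← sq, Real.sqrt_mul (sq_nonneg _), Real.sqrt_sq_eq_abs]

lemma chartVol_eq [BorelSpace X] [IsManifold 𝓘(ℂ, EuclideanSpace ℂ (Fin n)) ω X]
    {φ ψ : OpenPartialHomeomorph X (EuclideanSpace ℂ (Fin n))}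
    (hφ : φ ∈ atlas (EuclideanSpace ℂ (Fin n)) X) (hψ : ψ ∈ atlas (EuclideanSpace ℂ (Fin n)) X)
    {A : Set X} (hA : MeasurableSet A) (hAφ : A ⊆ φ.source) (hAψ : A ⊆ ψ.source) :
    Θ.chartVol φ A = Θ.chartVol ψ A := by
  rw [chartVol_apply _ hA, chartVol_apply _ hA, inter_eq_left.2 hAφ, inter_eq_left.2 hAψ]
  have himg : ψ '' A = (fun w => ψ (φ.symm w)) '' (φ '' A) := by
    rw [image_image]
    exact image_congr fun x hx => by rw [φ.left_inv (hAφ hx)]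
  have hmem : ∀ z ∈ φ '' A, z ∈ φ.target ∧ φ.symm z ∈ A := by
    rintro _ ⟨x, hx, rfl⟩
    exact ⟨φ.map_source (hAφ hx), by rwa [φ.left_inv (hAφ hx)]⟩
  choose! T hT hd using fun z (hz : z ∈ φ '' A) =>
    Θ.volDensity_change hφ hψ (hmem z hz).1 (hAψ (hmem z hz).2)
  have hinj : InjOn (fun w => ψ (φ.symm w)) (φ '' A) := by
    intro z hz w hw hzw
    exact φ.symm.injOn (hmem z hz).1 (hmem w hw).1
      (ψ.injOn (hAψ (hmem z hz).2) (hAψ (hmem w hw).2) hzw)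
  have hms := measurableSet_chart_image hA hAφ
  rw [himg, lintegral_image_eq_lintegral_abs_det_fderiv_mul volume hms
    (fun z hz => (hT z hz).hasFDerivWithinAt) hinj]
  refine setLIntegral_congr_fun hms fun z hz => ?_
  simp only [hd z hz, ENNReal.ofReal_mul (abs_nonneg _)]

/-- In the domain of every chart, the volume measure is given by the density `√(det g)`. -/
theorem vol_restrict_source [BorelSpace X] [SecondCountableTopology X]
    [IsManifold 𝓘(ℂ, EuclideanSpace ℂ (Fin n)) ω X]
    {φ : OpenPartialHomeomorph X (EuclideanSpace ℂ (Fin n))}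
    (hφ : φ ∈ atlas (EuclideanSpace ℂ (Fin n)) X) :
    Θ.vol.restrict φ.source = Θ.chartVol φ := by
  have hsupp : ∀ ψ : OpenPartialHomeomorph X (EuclideanSpace ℂ (Fin n)),
      ∀ A : Set X, MeasurableSet A → Θ.chartVol ψ A = Θ.chartVol ψ (A ∩ ψ.source) := by
    intro ψ A hA
    rw [chartVol_apply _ hA, chartVol_apply _ (hA.inter ψ.open_source.measurableSet),
      inter_assoc, inter_self]
  obtain ⟨t, htc, ht⟩ := TopologicalSpace.countable_cover_nhds
    (fun x : X => (chartAt (EuclideanSpace ℂ (Fin n)) x).open_source.mem_nhds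
      (mem_chart_source _ x))
  have : Countable t := htc
  -- a countable family of charts covering `X`, starting with `φ`
  obtain ⟨c, hc⟩ := exists_surjective_nat (Option t)
  let f : ℕ → OpenPartialHomeomorph X (EuclideanSpace ℂ (Fin n)) := fun i =>
    Nat.casesOn i φ fun k => (c k).elim φ fun x => chartAt _ (x : X)
  have hf : ∀ i, f i ∈ atlas (EuclideanSpace ℂ (Fin n)) X := by
    intro i
    rcases i with _ | k
    · exact hφ
    · rcases hk : c k with _ | x
      · simpa [f, hk] using hφ
      · simp [f, hk]
  have hcov : ⋃ i, (f i).source = univ := by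
    refine eq_univ_of_univ_subset (ht.symm.subset.trans (iUnion₂_subset fun x hx => ?_))
    obtain ⟨k, hk⟩ := hc (some ⟨x, hx⟩)
    refine subset_iUnion_of_subset (k + 1) ?_
    simp [f, hk]
  let D : ℕ → Set X := disjointed fun i => (f i).source
  have hDm : ∀ i, MeasurableSet (D i) :=
    fun i => .disjointed (fun i => (f i).open_source.measurableSet) i
  have hDd : Pairwise (Function.onFun Disjoint D) := disjoint_disjointed _
  have hDs : ∀ i, D i ⊆ (f i).source := fun i => disjointed_subset _ i
  have hDc : ⋃ i, D i = univ := by rw [iUnion_disjointed, hcov]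
  let ν : Measure X := Measure.sum fun i => (Θ.chartVol (f i)).restrict (D i)
  have hle : Θ.vol ≤ ν := by
    refine iSup₂_le fun ψ hψ => Measure.le_iff.2 fun A hA => ?_
    rw [hsupp ψ A hA, Measure.sum_apply _ hA]
    have hB := hA.inter ψ.open_source.measurableSet
    rw [← Measure.restrict_univ (μ := Θ.chartVol ψ), ← hDc,
      Measure.restrict_iUnion hDd hDm, Measure.sum_apply _ hB]
    refine ENNReal.tsum_le_tsum fun i => ?_
    rw [Measure.restrict_apply hB, Measure.restrict_apply hA,
      Θ.chartVol_eq hψ (hf i) (hB.inter (hDm i)) (fun x hx => hx.1.2) fun x hx => hDs i hx.2]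
    exact measure_mono fun x hx => ⟨hx.1.1, hx.2⟩
  refine Measure.ext fun A hA => ?_
  have hB := hA.inter φ.open_source.measurableSet
  rw [Measure.restrict_apply hA, hsupp φ A hA]
  refine le_antisymm ((hle _).trans ?_) ((le_iSup₂ (f := fun ψ _ => Θ.chartVol ψ) φ hφ) _)
  have h0 : D 0 = φ.source := disjointed_zero _
  rw [Measure.sum_apply _ hB, tsum_eq_single 0 fun i hi => ?_]
  · rw [Measure.restrict_apply hB]
    exact measure_mono inter_subset_left
  · rw [Measure.restrict_apply hB]
    have : A ∩ φ.source ∩ D i = ∅ := by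
      rw [← h0]
      exact eq_empty_of_forall_notMem fun x hx => (hDd hi).le_bot ⟨hx.2, hx.1.2⟩
    rw [this, measure_empty]

end HermitianForm

end Base

/-! ### Hermitian line bundles and their holomorphic sections -/

section Bundle

variable {n : ℕ} {X : Type*} [TopologicalSpace X] [ChartedSpace (EuclideanSpace ℂ (Fin n)) X]

variable (n) in
/-- A smooth Hermitian metric on the complex line bundle `L`. As usual in Mathlib, the inner
product is conjugate-linear in its first argument. -/
structure HermitianMetric (L : X → Type*) [TopologicalSpace (TotalSpace ℂ L)]
    [∀ x, AddCommGroup (L x)] [∀ x, Module ℂ (L x)] [∀ x, TopologicalSpace (L x)]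
    [FiberBundle ℂ L] [VectorBundle ℂ ℂ L] where
  /-- the inner product on each fibre -/
  inner (x : X) : L x →ₗ⋆[ℂ] L x →ₗ[ℂ] ℂ
  conj_symm : ∀ x u v, conj (inner x u v) = inner x v u
  positive : ∀ x v, v ≠ 0 → 0 < (inner x v v).re
  /-- the squared length of the frame `y ↦ e.symm y 1` of a local trivialization `e` is smooth -/
  smooth : ∀ (e : Trivialization ℂ (π ℂ L)) [MemTrivializationAtlas e],
    ContMDiffOn 𝓘(ℝ, EuclideanSpace ℂ (Fin n)) 𝓘(ℝ, ℝ) ∞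
      (fun y => (inner y (e.symm y 1) (e.symm y 1)).re) e.baseSet

variable {L : X → Type*} [TopologicalSpace (TotalSpace ℂ L)]
    [∀ x, AddCommGroup (L x)] [∀ x, Module ℂ (L x)] [∀ x, TopologicalSpace (L x)]
    [FiberBundle ℂ L] [VectorBundle ℂ ℂ L]

namespace HermitianMetric

variable (h : HermitianMetric n L)

/-- The length `|v|_h` of a vector in the fibre over `x`. -/
def norm (x : X) (v : L x) : ℝ := Real.sqrt (h.inner x v v).re

lemma inner_self_nonneg (x : X) (v : L x) : 0 ≤ (h.inner x v v).re := by
  by_cases hv : v = 0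
  · simp [hv]
  · exact (h.positive x v hv).le

lemma norm_nonneg (x : X) (v : L x) : 0 ≤ h.norm x v := Real.sqrt_nonneg _

/-- The inner product on a single fibre. -/
@[reducible]
def core (x : X) : PreInnerProductSpace.Core ℂ (L x) where
  inner u v := h.inner x u v
  conj_inner_symm u v := h.conj_symm x v u
  re_inner_nonneg v := h.inner_self_nonneg x v
  add_left u v w := by simp
  smul_left u v r := by simp

lemma norm_add_le (x : X) (u v : L x) : h.norm x (u + v) ≤ h.norm x u + h.norm x v := by
  let _ : PreInnerProductSpace.Core ℂ (L x) := h.core x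
  let _ : SeminormedAddCommGroup (L x) :=
    InnerProductSpace.Core.toSeminormedAddCommGroup (𝕜 := ℂ)
  exact (InnerProductSpace.Core.toSeminormedSpaceCore (h.core x)).norm_triangle u v

lemma norm_smul (x : X) (c : ℂ) (v : L x) : h.norm x (c • v) = ‖c‖ * h.norm x v := by
  let _ : PreInnerProductSpace.Core ℂ (L x) := h.core x
  let _ : SeminormedAddCommGroup (L x) :=
    InnerProductSpace.Core.toSeminormedAddCommGroup (𝕜 := ℂ)
  exact (InnerProductSpace.Core.toSeminormedSpaceCore (h.core x)).norm_smul c v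

lemma norm_inner_le (x : X) (u v : L x) : ‖h.inner x u v‖ ≤ h.norm x u * h.norm x v := by
  let _ : PreInnerProductSpace.Core ℂ (L x) := h.core x
  exact InnerProductSpace.Core.norm_inner_le_norm (𝕜 := ℂ) u v

lemma sq_norm (x : X) (v : L x) : h.norm x v ^ 2 = (h.inner x v v).re :=
  Real.sq_sqrt (h.inner_self_nonneg x v)

end HermitianMetric

variable (n L) in
/-- The holomorphic (i.e. complex differentiable) sections of `L`, as a subspace of the space
of all sections. -/
def holSubmodule [ContMDiffVectorBundle ω ℂ L 𝓘(ℂ, EuclideanSpace ℂ (Fin n))] :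
    Submodule ℂ (∀ x, L x) where
  carrier := {s | MDifferentiable 𝓘(ℂ, EuclideanSpace ℂ (Fin n))
    (𝓘(ℂ, EuclideanSpace ℂ (Fin n)).prod 𝓘(ℂ, ℂ)) fun x => TotalSpace.mk' ℂ x (s x)}
  add_mem' hs ht := mdifferentiable_add_section hs ht
  zero_mem' := mdifferentiable_zeroSection ℂ L
  smul_mem' _ _ hs x := (hs x).smul_const_section

variable [ContMDiffVectorBundle ω ℂ L 𝓘(ℂ, EuclideanSpace ℂ (Fin n))]

/-- The space `H⁰(X, L)` of holomorphic sections of `L`; the metric `h` is recorded because it is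
used to describe the topology. -/
def HolSection (_h : HermitianMetric n L) : Type _ := ↥(holSubmodule n L)

namespace HolSection

variable {h : HermitianMetric n L}

instance : AddCommGroup (HolSection h) := inferInstanceAs (AddCommGroup ↥(holSubmodule n L))

instance : Module ℂ (HolSection h) := inferInstanceAs (Module ℂ ↥(holSubmodule n L))

/-- The value of a holomorphic section at a point. -/
def toSection (s : HolSection h) : ∀ x, L x := Subtype.val (p := (· ∈ holSubmodule n L)) s

instance : CoeFun (HolSection h) (fun _ => ∀ x, L x) := ⟨toSection⟩

lemma add_apply (s t : HolSection h) (x : X) : (s + t) x = s x + t x := rfl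

lemma smul_apply (c : ℂ) (s : HolSection h) (x : X) : (c • s) x = c • s x := rfl

lemma eq_smul_frame (s : HolSection h) (x₀ x : X)
    (hx : x ∈ (trivializationAt ℂ L x₀).baseSet) :
    s x = (trivializationAt ℂ L x₀ ⟨x, s x⟩).2 • (trivializationAt ℂ L x₀).symm x 1 := by
  have h1 := (trivializationAt ℂ L x₀).symm_apply_apply_mk hx (s x)
  have h2 : ∀ c : ℂ, (trivializationAt ℂ L x₀).symm x c
      = c • (trivializationAt ℂ L x₀).symm x 1 := fun c => by
    have h3 := Trivialization.coe_symmₗ (R := ℂ) (trivializationAt ℂ L x₀) hx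
    rw [← h3, ← map_smul, smul_eq_mul, mul_one]
  rw [← h2, h1]

lemma continuous_inner (s t : HolSection h) : Continuous fun x => h.inner x (s x) (t x) := by
  rw [continuous_iff_continuousAt]
  intro x₀
  have hc : ∀ s : HolSection h,
      ContinuousAt (fun x => (trivializationAt ℂ L x₀ ⟨x, s x⟩).2) x₀ := fun s =>
    ((mdifferentiableAt_section 𝓘(ℂ, EuclideanSpace ℂ (Fin n)) (F := ℂ) s.toSection).1
      (s.2 x₀)).continuousAt
  have hbase : (trivializationAt ℂ L x₀).baseSet ∈ 𝓝 x₀ :=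
    (trivializationAt ℂ L x₀).open_baseSet.mem_nhds (mem_baseSet_trivializationAt ℂ L x₀)
  have hh : ContinuousAt (fun y => (h.inner y ((trivializationAt ℂ L x₀).symm y 1)
      ((trivializationAt ℂ L x₀).symm y 1)).re) x₀ :=
    (h.smooth (trivializationAt ℂ L x₀)).continuousOn.continuousAt hbase
  have key : ContinuousAt (fun x => conj (trivializationAt ℂ L x₀ ⟨x, s x⟩).2 *
      ((trivializationAt ℂ L x₀ ⟨x, t x⟩).2 *
        (((h.inner x ((trivializationAt ℂ L x₀).symm x 1)
          ((trivializationAt ℂ L x₀).symm x 1)).re : ℝ) : ℂ))) x₀ :=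
    (Complex.continuous_conj.continuousAt.comp (hc s)).mul
      ((hc t).mul (Complex.continuous_ofReal.continuousAt.comp hh))
  refine key.congr ?_
  filter_upwards [hbase] with x hx
  rw [Complex.conj_eq_iff_re.1 (h.conj_symm x _ _)]
  conv_rhs => rw [s.eq_smul_frame x₀ x hx, t.eq_smul_frame x₀ x hx]
  simp only [map_smulₛₗ, LinearMap.smul_apply, smul_eq_mul, RingHom.id_apply]
  ring

lemma continuous_norm (s : HolSection h) : Continuous fun x => h.norm x (s x) :=
  (Complex.continuous_re.comp (s.continuous_inner s)).sqrt

lemma bddAbove_norm (s : HolSection h) (K : TopologicalSpace.Compacts X) :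
    BddAbove (range fun x : K => h.norm x (s x)) := by
  have := K.isCompact.bddAbove_image s.continuous_norm.continuousOn
  rwa [image_eq_range] at this

variable (h) in
/-- The seminorm `s ↦ sup_{x ∈ K} |s(x)|_h` on `H⁰(X, L)`, for `K ⊆ X` compact. -/
def supSeminorm (K : TopologicalSpace.Compacts X) : Seminorm ℂ (HolSection h) :=
  Seminorm.of (fun s => ⨆ x : K, h.norm x (s x))
    (fun s t => by
      refine Real.iSup_le (fun x => ?_) (add_nonneg
        (Real.iSup_nonneg fun _ => h.norm_nonneg _ _) (Real.iSup_nonneg fun _ => h.norm_nonneg _ _))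
      exact (h.norm_add_le _ _ _).trans
        (add_le_add (le_ciSup (s.bddAbove_norm K) x) (le_ciSup (t.bddAbove_norm K) x)))
    (fun c s => by
      simp only [smul_apply, h.norm_smul]
      exact (Real.mul_iSup_of_nonneg (_root_.norm_nonneg c) _).symm)

/-- The topology of uniform convergence on compact sets, given by the seminorms `supSeminorm`. -/
instance : TopologicalSpace (HolSection h) :=
  (SeminormFamily.moduleFilterBasis (𝕜 := ℂ) (supSeminorm h)).topology

lemma withSeminorms : WithSeminorms (𝕜 := ℂ) (supSeminorm h) := ⟨rfl⟩

/-- The Borel `σ`-algebra of `H⁰(X, L)`. -/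
instance : MeasurableSpace (HolSection h) := borel _

instance : BorelSpace (HolSection h) := ⟨rfl⟩

/-- Locally uniform convergence (uniform convergence on every compact set) of a sequence of
sections. -/
def ConvergesLocallyUniformly (F : ℕ → HolSection h) (s : HolSection h) : Prop :=
  ∀ K : Set X, IsCompact K → ∀ ε > 0, ∀ᶠ N in atTop, ∀ x ∈ K, h.norm x (F N x - s x) < ε

end HolSection

/-! ### Square integrable holomorphic sections -/

section L2

variable [MeasurableSpace X] [BorelSpace X]

lemma integrable_inner {Θ : HermitianForm n X} {h : HermitianMetric n L} {s t : HolSection h}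
    (hs : Integrable (fun x => h.norm x (s x) ^ 2) Θ.vol)
    (ht : Integrable (fun x => h.norm x (t x) ^ 2) Θ.vol) :
    Integrable (fun x => h.inner x (s x) (t x)) Θ.vol := by
  refine (hs.add ht).mono' (s.continuous_inner t).aestronglyMeasurable (.of_forall fun x => ?_)
  have := h.norm_inner_le x (s x) (t x)
  simp only [Pi.add_apply]
  nlinarith [sq_nonneg (h.norm x (s x) - h.norm x (t x)), sq_nonneg (h.norm x (s x)),
    sq_nonneg (h.norm x (t x))]

/-- The holomorphic sections `s` with `∫ |s|²_h dV < ∞`, as a subspace of `H⁰(X, L)`. -/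
def l2Submodule (Θ : HermitianForm n X) (h : HermitianMetric n L) :
    Submodule ℂ (HolSection h) where
  carrier := {s | Integrable (fun x => h.norm x (s x) ^ 2) Θ.vol}
  add_mem' {s t} hs ht := by
    refine ((hs.add ht).const_mul 2).mono' ((s + t).continuous_norm.pow 2).aestronglyMeasurable
      (.of_forall fun x => ?_)
    have h1 := h.norm_add_le x (s x) (t x)
    have h2 := h.norm_nonneg x (s x + t x)
    rw [HolSection.add_apply, Real.norm_of_nonneg (sq_nonneg _)]
    simp only [Pi.add_apply]
    nlinarith [sq_nonneg (h.norm x (s x) - h.norm x (t x))]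
  zero_mem' := by
    have : ∀ x, h.norm x ((0 : HolSection h) x) ^ 2 = 0 := fun x => by
      rw [h.sq_norm]
      change (h.inner x 0 0).re = 0
      simp
    simp only [mem_ofPred_eq, this]
    exact integrable_zero _ _ _
  smul_mem' c s hs := by
    simp only [mem_ofPred_eq, HolSection.smul_apply, h.norm_smul, mul_pow] at hs ⊢
    exact hs.const_mul _

/-- The space `H⁰₍₂₎(X, L)` of square integrable holomorphic sections. -/
def L2HolSection (Θ : HermitianForm n X) (h : HermitianMetric n L) : Type _ :=
  ↥(l2Submodule Θ h)

namespace L2HolSection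

variable {Θ : HermitianForm n X} {h : HermitianMetric n L}

instance : AddCommGroup (L2HolSection Θ h) := inferInstanceAs (AddCommGroup ↥(l2Submodule Θ h))

instance : Module ℂ (L2HolSection Θ h) := inferInstanceAs (Module ℂ ↥(l2Submodule Θ h))

/-- The underlying holomorphic section. -/
def toHol (s : L2HolSection Θ h) : HolSection h := Subtype.val (p := (· ∈ l2Submodule Θ h)) s

variable (Θ h) in
/-- The inner product `⟨s, t⟩ = ∫ ⟨s(x), t(x)⟩_h dV(x)`. -/
@[reducible]
def core : PreInnerProductSpace.Core ℂ (L2HolSection Θ h) where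
  inner s t := ∫ x, h.inner x (s.toHol x) (t.toHol x) ∂Θ.vol
  conj_inner_symm s t := by
    rw [← integral_conj]
    exact integral_congr_ae (.of_forall fun x => h.conj_symm x _ _)
  re_inner_nonneg s := by
    have h1 : ∫ x, h.inner x (s.toHol x) (s.toHol x) ∂Θ.vol
        = ((∫ x, h.norm x (s.toHol x) ^ 2 ∂Θ.vol : ℝ) : ℂ) := by
      rw [← integral_complex_ofReal]
      refine integral_congr_ae (.of_forall fun x => ?_)
      simp only [h.sq_norm]
      exact (Complex.conj_eq_iff_re.1 (h.conj_symm x _ _)).symm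
    rw [h1]
    simpa using integral_nonneg fun x => sq_nonneg (h.norm x (s.toHol x))
  add_left s t u := by
    refine Eq.trans ?_ (integral_add (integrable_inner s.2 u.2) (integrable_inner t.2 u.2))
    refine integral_congr_ae (.of_forall fun x => ?_)
    change h.inner x (s.toHol x + t.toHol x) _ = _
    simp
  smul_left s t c := by
    rw [← integral_const_mul]
    refine integral_congr_ae (.of_forall fun x => ?_)
    change h.inner x (c • s.toHol x) _ = _
    simp

instance : SeminormedAddCommGroup (L2HolSection Θ h) :=
  @InnerProductSpace.Core.toSeminormedAddCommGroup ℂ _ _ _ _ (core Θ h)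

instance : InnerProductSpace ℂ (L2HolSection Θ h) :=
  InnerProductSpace.ofCore (core Θ h)

variable (Θ h) in
/-- An orthonormal (Hilbert) basis of `H⁰₍₂₎(X, L)`: an orthonormal family whose linear span
is dense for the `L²` norm. -/
structure IsOrthonormalBasis {ι : Type*} (S : ι → L2HolSection Θ h) : Prop where
  orthonormal : Orthonormal ℂ S
  dense : Dense (Submodule.span ℂ (range S) : Set (L2HolSection Θ h))

end L2HolSection

end L2
end Bundle

/-! ### Random holomorphic sections -/

/-- The index set `{j : j < d}` of an orthonormal basis `S_0, S_1, …` of a Hilbert space of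
dimension `d ∈ ℕ ∪ {∞}`. -/
abbrev BasisIndex (d : ℕ∞) : Type := {j : ℕ // (j : ℕ∞) < d}

section Random

variable {Ω ι : Type*} [MeasurableSpace Ω]

/-- Independent, identically distributed, centered Gaussian random variables with values in
`ℂ = ℝ²`. Real Gaussian variables are the case of a law carried by `ℝ ⊆ ℂ`. -/
structure IsIIDCenteredGaussian (η : ι → Ω → ℂ) (P : Measure Ω) : Prop where
  gaussian : ∀ j, HasGaussianLaw (η j) P
  centered : ∀ j, ∫ w, η j w ∂P = 0
  identDistrib : ∀ i j, IdentDistrib (η i) (η j) P P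
  indep : iIndepFun η P

/-- The standard complex Gaussian law: the law of `(U + i V) / √2` for independent standard real
Gaussian variables `U`, `V`. -/
def stdComplexGaussian : Measure ℂ :=
  ((gaussianReal 0 1).prod (gaussianReal 0 1)).map
    fun p : ℝ × ℝ => ((p.1 : ℂ) + Complex.I * (p.2 : ℂ)) / (Real.sqrt 2 : ℂ)

/-- Independent standard complex Gaussian random variables. -/
structure IsIIDStdComplexGaussian (η : ι → Ω → ℂ) (P : Measure Ω) : Prop where
  law : ∀ j, HasLaw (η j) stdComplexGaussian P
  indep : iIndepFun η P

end Random

section PartialSum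

variable {n : ℕ} {X : Type*} [TopologicalSpace X] [ChartedSpace (EuclideanSpace ℂ (Fin n)) X]
  [MeasurableSpace X] [BorelSpace X]
  {L : X → Type*} [TopologicalSpace (TotalSpace ℂ L)]
  [∀ x, AddCommGroup (L x)] [∀ x, Module ℂ (L x)] [∀ x, TopologicalSpace (L x)]
  [FiberBundle ℂ L] [VectorBundle ℂ ℂ L]
  [ContMDiffVectorBundle ω ℂ L 𝓘(ℂ, EuclideanSpace ℂ (Fin n))]
  {Θ : HermitianForm n X} {h : HermitianMetric n L}

/-- The partial sum `∑ c_j S_j` over all indices `j < N` (and `j < d`). -/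
def partialSum {d : ℕ∞} (S : BasisIndex d → L2HolSection Θ h) (c : BasisIndex d → ℂ) (N : ℕ) :
    HolSection h :=
  ∑ j ∈ Finset.range N, if hj : (j : ℕ∞) < d then c ⟨j, hj⟩ • (S ⟨j, hj⟩).toHol else 0

/-- The random section `ψ` is the sum of the series `∑ η_j S_j`: almost surely, the partial sums
converge to `ψ` locally uniformly on `X`. -/
def IsGaussianSeries {Ω : Type*} [MeasurableSpace Ω] (P : Measure Ω) {d : ℕ∞}
    (S : BasisIndex d → L2HolSection Θ h) (η : BasisIndex d → Ω → ℂ) (ψ : Ω → HolSection h) :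
    Prop :=
  ∀ᵐ w ∂P, HolSection.ConvergesLocallyUniformly (partialSum S fun j => η j w) (ψ w)

end PartialSum

end GaussSec

end

/-!
In a chart and a local frame, a section is a holomorphic function of `n` complex variables, and the
mean value property bounds its supremum on a compact set by its `L²` norm on a slightly larger one.
Hence evaluation at a point is a bounded functional on `H⁰₍₂₎(X, L)`, locally uniformly in the
point, and Bessel's inequality gives `∑ ‖T S_j‖² < ∞` for the restriction
`T : H⁰₍₂₎(X, L) → L²(K)` to a compact set `K` of coordinates. Kolmogorov's maximal inequality in
the Hilbert space `L²(K)` then shows that `∑ η_j T S_j` is almost surely Cauchy, and the same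
interior estimate, used a second time, upgrades `L²` convergence of the partial sums to uniform
convergence. Countably many `K` suffice.

The law of `ψ` is determined by the characteristic functions of `Re (ℓ ψ)`, where `ℓ` runs through
the continuous linear functionals on `H⁰(X, L)`, because `H⁰(X, L)` carries the topology induced
from countably many spaces `C(K, ℂ)`. The restriction of `ℓ` to `H⁰₍₂₎(X, L)` is bounded, and by
independence the characteristic function of `Re (ℓ ψ)` at `1` is `exp (-∑ |ℓ (S_j)|² / 4)`.
Parseval's identity makes `∑ |ℓ (S_j)|²` independent of the orthonormal basis.
-/

noncomputable section

namespace GaussSec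

/-! ### Holomorphic functions of several variables -/

section MeanValue

variable {E : Type*} [NormedAddCommGroup E] [NormedSpace ℂ E] [FiniteDimensional ℂ E]
  [MeasurableSpace E] [BorelSpace E] (μ : Measure E) [μ.IsAddHaarMeasure]

theorem measurePreserving_smul_of_norm_eq_one {c : ℂ} (hc : ‖c‖ = 1) :
    MeasurePreserving (fun w : E => c • w) μ μ := by
  have hc0 : c ≠ 0 := norm_ne_zero_iff.1 (hc ▸ one_ne_zero)
  let e : E ≃L[ℂ] E := ContinuousLinearEquiv.smulLeft (Units.mk0 c hc0)
  have hmap : (μ.map e).IsAddHaarMeasure :=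
    e.toContinuousAddEquiv.isAddHaarMeasure_map μ
  refine ⟨e.continuous.measurable, ?_⟩
  have hball : μ.map e (Metric.ball 0 1) = μ (Metric.ball 0 1) := by
    rw [Measure.map_apply e.continuous.measurable Metric.isOpen_ball.measurableSet]
    congr 1
    ext w
    simp [e, norm_smul, hc]
  obtain ⟨k, hk⟩ : ∃ k : NNReal, μ.map e = k • μ :=
    ⟨_, Measure.isAddLeftInvariant_eq_smul (μ.map e) μ⟩
  rw [hk, Measure.smul_apply, ENNReal.smul_def, smul_eq_mul] at hball
  have hk1 : (k : ℝ≥0∞) = 1 :=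
    (ENNReal.mul_eq_right (Metric.measure_ball_pos μ _ one_pos).ne' measure_ball_lt_top.ne).1 hball
  change μ.map e = μ
  rw [hk, ENNReal.coe_eq_one.1 hk1, one_smul]

variable {μ} {F : Type*} [NormedAddCommGroup F] [NormedSpace ℂ F]

theorem setIntegral_smul_closedBall_zero (f : E → F) (r : ℝ) {c : ℂ} (hc : ‖c‖ = 1) :
    ∫ w in Metric.closedBall 0 r, f (c • w) ∂μ = ∫ w in Metric.closedBall 0 r, f w ∂μ := by
  have hc0 : c ≠ 0 := norm_ne_zero_iff.1 (hc ▸ one_ne_zero)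
  have hpre : (fun w : E => c • w) ⁻¹' Metric.closedBall 0 r = Metric.closedBall 0 r := by
    ext w
    simp [norm_smul, hc]
  simpa only [hpre] using (measurePreserving_smul_of_norm_eq_one μ hc).setIntegral_preimage_emb
    (Homeomorph.smulOfNeZero c hc0).measurableEmbedding f (Metric.closedBall 0 r)

theorem integral_circleMap_smul_eq {E F : Type*} [NormedAddCommGroup E] [NormedSpace ℂ E]
    [NormedAddCommGroup F] [NormedSpace ℂ F] [CompleteSpace F] {f : E → F} {r : ℝ}
    (hf : DifferentiableOn ℂ f (Metric.closedBall 0 r)) {w : E} (hw : w ∈ Metric.closedBall 0 r) :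
    ∫ θ in 0..2 * Real.pi, f (circleMap 0 1 θ • w) = (2 * Real.pi) • f 0 := by
  have hmaps : MapsTo (fun ζ : ℂ => ζ • w) (Metric.closedBall 0 1) (Metric.closedBall 0 r) :=
    fun ζ hζ => by
      simp only [mem_closedBall_zero_iff] at hζ hw ⊢
      rw [norm_smul]
      nlinarith [norm_nonneg w]
  have hd : DiffContOnCl ℂ (fun ζ : ℂ => f (ζ • w)) (Metric.ball 0 |1|) := by
    refine DifferentiableOn.diffContOnCl ?_
    rw [abs_one, closure_ball _ one_ne_zero]
    exact hf.comp (differentiable_id.smul_const w).differentiableOn hmaps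
  have hmean := hd.circleAverage
  rw [Real.circleAverage_def, inv_smul_eq_iff₀ Real.two_pi_pos.ne', zero_smul] at hmean
  exact hmean

variable [CompleteSpace F]

theorem setIntegral_closedBall_zero_of_differentiableOn {f : E → F} {r : ℝ}
    (hf : DifferentiableOn ℂ f (Metric.closedBall 0 r)) :
    ∫ w in Metric.closedBall 0 r, f w ∂μ = μ.real (Metric.closedBall 0 r) • f 0 := by
  have hcont : ContinuousOn (fun p : ℝ × E => f (circleMap 0 1 p.1 • p.2))
      (uIcc 0 (2 * Real.pi) ×ˢ Metric.closedBall 0 r) :=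
    hf.continuousOn.comp (by fun_prop) fun p hp => by
      simpa [norm_smul] using hp.2
  have hint : Integrable (Function.uncurry fun (θ : ℝ) (w : E) => f (circleMap 0 1 θ • w))
      ((volume.restrict (uIoc 0 (2 * Real.pi))).prod (μ.restrict (Metric.closedBall 0 r))) := by
    rw [Measure.prod_restrict]
    exact (hcont.integrableOn_compact (isCompact_uIcc.prod (isCompact_closedBall 0 r))).mono_set
      (prod_mono_left uIoc_subset_uIcc)
  have hswap := intervalIntegral_integral_swap hint
  have hrot (θ : ℝ) := setIntegral_smul_closedBall_zero (μ := μ) f r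
    (c := circleMap 0 1 θ) (by simp)
  rw [setIntegral_congr_fun measurableSet_closedBall
    fun w hw => integral_circleMap_smul_eq hf hw] at hswap
  simp only [hrot, intervalIntegral.integral_const, setIntegral_const, sub_zero] at hswap
  rw [smul_comm] at hswap
  exact smul_right_injective F Real.two_pi_pos.ne' hswap

theorem setIntegral_closedBall_of_differentiableOn {f : E → F} {z : E} {r : ℝ}
    (hf : DifferentiableOn ℂ f (Metric.closedBall z r)) :
    ∫ w in Metric.closedBall z r, f w ∂μ = μ.real (Metric.closedBall 0 r) • f z := by
  have hpre : (fun w => z + w) ⁻¹' Metric.closedBall z r = Metric.closedBall 0 r := by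
    ext w
    simp
  have hmean := setIntegral_closedBall_zero_of_differentiableOn (μ := μ) (r := r)
    (f := fun w => f (z + w)) (hf.comp (by fun_prop) fun w hw => by simpa using hw)
  rw [← (measurePreserving_add_left μ z).setIntegral_preimage_emb (measurableEmbedding_addLeft z),
    hpre, hmean, add_zero]

theorem enorm_sq_mul_measure_closedBall_le {f : E → ℂ} {z : E} {r : ℝ}
    (hf : DifferentiableOn ℂ f (Metric.closedBall z r)) :
    ‖f z‖ₑ ^ 2 * μ (Metric.closedBall 0 r) ≤ ∫⁻ w in Metric.closedBall z r, ‖f w‖ₑ ^ 2 ∂μ := by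
  have hle := enorm_integral_le_lintegral_enorm (μ := μ.restrict (Metric.closedBall z r))
    (f ^ 2)
  rw [setIntegral_closedBall_of_differentiableOn (hf.pow 2), enorm_smul, mul_comm] at hle
  simpa [enorm_pow, Real.enorm_of_nonneg measureReal_nonneg,
    ofReal_measureReal measure_closedBall_lt_top.ne] using hle

theorem exists_forall_enorm_sq_le_mul_setLIntegral {K U : Set E} (hK : IsCompact K)
    (hU : IsOpen U) (hKU : K ⊆ U) :
    ∃ C : NNReal, ∀ f : E → ℂ, DifferentiableOn ℂ f U → ∀ z ∈ K,
      ‖f z‖ₑ ^ 2 ≤ C * ∫⁻ w in U, ‖f w‖ₑ ^ 2 ∂μ := by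
  obtain ⟨r, hr, hrU⟩ := hK.exists_cthickening_subset_open hU hKU
  have hpos : μ (Metric.closedBall (0 : E) r) ≠ 0 := (Metric.measure_closedBall_pos μ _ hr).ne'
  have hfin : μ (Metric.closedBall (0 : E) r) ≠ ⊤ := measure_closedBall_lt_top.ne
  refine ⟨(μ (Metric.closedBall (0 : E) r))⁻¹.toNNReal, fun f hf z hz => ?_⟩
  have hball : Metric.closedBall z r ⊆ U :=
    (Metric.closedBall_subset_cthickening hz r).trans hrU
  rw [ENNReal.coe_toNNReal (ENNReal.inv_ne_top.2 hpos), mul_comm, ← div_eq_mul_inv,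
    ENNReal.le_div_iff_mul_le (.inl hpos) (.inl hfin)]
  exact (enorm_sq_mul_measure_closedBall_le (hf.mono hball)).trans (lintegral_mono_set hball)

end MeanValue

section Weierstrass

variable {E F ι : Type*} [NormedAddCommGroup E] [NormedSpace ℂ E] [NormedAddCommGroup F]
  [NormedSpace ℂ F] {p : Filter ι} {f : ι → E → F} {g : E → F} {U V : Set E}

theorem uniformCauchySeqOn_fderiv {r : ℝ} (hr : 0 < r) (hVU : ∀ w ∈ V, Metric.ball w r ⊆ U)
    (hf : ∀ i, DifferentiableOn ℂ (f i) U) (hc : UniformCauchySeqOn f p U) :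
    UniformCauchySeqOn (fun i => fderiv ℂ (f i)) p V := by
  intro u hu
  obtain ⟨ε, hε, hεu⟩ := Metric.mem_uniformity_dist.1 hu
  filter_upwards [hc _ (Metric.dist_mem_uniformity (show 0 < ε * r / 4 by positivity))]
    with ⟨i, j⟩ hij w hw
  have hd (k : ι) : DifferentiableAt ℂ (f k) w :=
    ((hf k).mono (hVU w hw)).differentiableAt (Metric.ball_mem_nhds w hr)
  have hmaps : MapsTo (f i - f j) (Metric.ball w r)
      (Metric.closedBall ((f i - f j) w) (ε * r / 2)) := fun y hy => by
    have hy' : dist (f i y) (f j y) < ε * r / 4 := hij y (hVU w hw hy)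
    have hw' : dist (f i w) (f j w) < ε * r / 4 := hij w (hVU w hw (Metric.mem_ball_self hr))
    rw [dist_eq_norm] at hy' hw'
    rw [mem_closedBall_iff_norm]
    exact (norm_sub_le _ _).trans (by simp only [Pi.sub_apply]; linarith)
  have hle := Complex.norm_fderiv_le_div_of_mapsTo_ball
    (((hf i).sub (hf j)).mono (hVU w hw)) hmaps hr
  rw [fderiv_sub (hd i) (hd j), ← dist_eq_norm] at hle
  refine hεu (hle.trans_lt ?_)
  field_simp
  linarith

theorem differentiableOn_of_tendstoLocallyUniformlyOn [LocallyCompactSpace E] [CompleteSpace F]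
    [p.NeBot] (hU : IsOpen U) (hf : ∀ i, DifferentiableOn ℂ (f i) U)
    (hfg : TendstoLocallyUniformlyOn f g p U) :
    DifferentiableOn ℂ g U := by
  intro z hz
  obtain ⟨t, ht, htU, htc⟩ := local_compact_nhds (hU.mem_nhds hz)
  have htg := (tendstoLocallyUniformlyOn_iff_forall_isCompact hU).1 hfg t htU htc
  obtain ⟨r, hr, hrt⟩ := Metric.mem_nhds_iff.1 ht
  have hball : ∀ w ∈ Metric.ball z (r / 2), Metric.ball w (r / 2) ⊆ t := fun w hw =>
    (Metric.ball_subset_ball' (by rw [Metric.mem_ball] at hw; linarith)).trans hrt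
  have hself : ∀ w : E, w ∈ Metric.ball w (r / 2) := fun w => Metric.mem_ball_self (half_pos hr)
  have hc := uniformCauchySeqOn_fderiv (half_pos hr) hball (fun i => (hf i).mono htU)
    htg.uniformCauchySeqOn
  have hlim : ∀ w ∈ Metric.ball z (r / 2), ∃ T, Tendsto (fun i => fderiv ℂ (f i) w) p (𝓝 T) :=
    fun w hw => cauchy_map_iff_exists_tendsto.1 (hc.cauchy_map hw)
  choose! g' hg' using hlim
  refine (hasFDerivAt_of_tendstoUniformlyOn Metric.isOpen_ball
    (hc.tendstoUniformlyOn_of_tendsto hg') (fun i w hw => ?_)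
    (fun w hw => htg.tendsto_at (hball w hw (hself w)))
    (hself z)).differentiableAt.differentiableWithinAt
  exact ((hf i).differentiableAt (hU.mem_nhds (htU (hball w hw (hself w))))).hasFDerivAt

end Weierstrass

/-! ### Series of independent random vectors -/

section RandomSeries

theorem stronglyMeasurable_sum_range_natural {H Ω : Type*} [NormedAddCommGroup H]
    [MeasurableSpace H] [BorelSpace H] [MeasurableSpace Ω] {ξ : ℕ → Ω → H}
    (hm : ∀ j, StronglyMeasurable (ξ j)) (N : ℕ) :
    StronglyMeasurable[Filtration.natural ξ hm N] fun w => ∑ j ∈ Finset.range (N + 1), ξ j w :=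
  Finset.stronglyMeasurable_fun_sum _ fun j hj =>
    (Filtration.stronglyAdapted_natural hm j).mono
      ((Filtration.natural ξ hm).mono (Nat.lt_succ_iff.1 (Finset.mem_range.1 hj)))

theorem cauchySeq_sum_range_of_forall_exists {H : Type*} [SeminormedAddCommGroup H] {u : ℕ → H}
    (hu : ∀ p : ℕ, ∃ m, ∀ k, ‖∑ j ∈ Finset.range (k + 1), u (m + j)‖ ^ 2 < 1 / ((p : ℝ) + 1)) :
    CauchySeq fun N => ∑ j ∈ Finset.range N, u j := by
  rw [Metric.cauchySeq_iff']
  intro ε hε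
  obtain ⟨p, hp⟩ := exists_nat_one_div_lt (show 0 < ε ^ 2 by positivity)
  obtain ⟨m, hm⟩ := hu p
  refine ⟨m, fun N hN => ?_⟩
  obtain ⟨k, rfl⟩ := Nat.exists_eq_add_of_le hN
  rw [dist_eq_norm, Finset.sum_range_add, add_sub_cancel_left]
  rcases k with _ | k
  · simpa using hε
  · exact lt_of_pow_lt_pow_left₀ 2 hε.le ((hm k).trans hp)

variable {H Ω : Type*} [NormedAddCommGroup H] [InnerProductSpace ℝ H] [CompleteSpace H]
  [MeasurableSpace H] [BorelSpace H] [MeasurableSpace Ω] {P : Measure Ω}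

theorem setIntegral_norm_add_sq_of_indepFun [IsFiniteMeasure P] {X Y : Ω → H} {s : Set Ω}
    (hs : MeasurableSet s) (hX : MemLp X 2 P) (hY : MemLp Y 2 P) (hY0 : ∫ w, Y w ∂P = 0)
    (hXY : IndepFun (s.indicator X) Y P) :
    ∫ w in s, ‖X w + Y w‖ ^ 2 ∂P = ∫ w in s, ‖X w‖ ^ 2 ∂P + ∫ w in s, ‖Y w‖ ^ 2 ∂P := by
  have hcross : ∫ w in s, inner ℝ (X w) (Y w) ∂P = 0 := by
    calc ∫ w in s, inner ℝ (X w) (Y w) ∂P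
        = ∫ w, innerSL ℝ (s.indicator X w) (Y w) ∂P := by
          rw [← integral_indicator hs]
          refine integral_congr_ae (.of_forall fun w => ?_)
          by_cases hw : w ∈ s <;> simp [hw]
      _ = 0 := by
          rw [hXY.integral_bilin ((hX.integrable one_le_two).indicator hs)
            (hY.integrable one_le_two), hY0, map_zero]
  have hX2 := (hX.integrable_norm_pow two_ne_zero).restrict (s := s)
  have hY2 := (hY.integrable_norm_pow two_ne_zero).restrict (s := s)
  have hXYi : Integrable (fun w => 2 * inner ℝ (X w) (Y w)) (P.restrict s) :=
    ((memLp_one_iff_integrable.1 ((innerSL ℝ).memLp_of_bilin 1 hX hY)).const_mul 2).restrict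
  simp only [norm_add_sq_real]
  refine (integral_add (hX2.add hXYi) hY2).trans ?_
  congr 1
  refine (integral_add hX2 hXYi).trans ?_
  rw [integral_const_mul, hcross, mul_zero, add_zero]

variable {ξ : ℕ → Ω → H} [IsProbabilityMeasure P]

theorem setIntegral_norm_sum_range_succ_sq (hm : ∀ j, StronglyMeasurable (ξ j))
    (hL : ∀ j, MemLp (ξ j) 2 P) (h0 : ∀ j, ∫ w, ξ j w ∂P = 0) (hi : iIndepFun ξ P) (N : ℕ)
    {s : Set Ω} (hs : MeasurableSet[Filtration.natural ξ hm N] s) :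
    ∫ w in s, ‖∑ j ∈ Finset.range (N + 2), ξ j w‖ ^ 2 ∂P =
      ∫ w in s, ‖∑ j ∈ Finset.range (N + 1), ξ j w‖ ^ 2 ∂P +
        ∫ w in s, ‖ξ (N + 1) w‖ ^ 2 ∂P := by
  have hind : IndepFun (s.indicator fun w => ∑ j ∈ Finset.range (N + 1), ξ j w) (ξ (N + 1)) P :=
    indep_of_indep_of_le_left (hi.indep_comap_natural_of_lt hm N.lt_succ_self).symm
      ((stronglyMeasurable_sum_range_natural hm N).indicator hs).measurable.comap_le
  simp only [Finset.sum_range_succ _ (N + 1)]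
  exact setIntegral_norm_add_sq_of_indepFun ((Filtration.natural ξ hm).le N s hs)
    (memLp_finsetSum _ fun j _ => hL j) (hL (N + 1)) (h0 (N + 1)) hind

theorem submartingale_norm_sum_range_sq (hm : ∀ j, StronglyMeasurable (ξ j))
    (hL : ∀ j, MemLp (ξ j) 2 P) (h0 : ∀ j, ∫ w, ξ j w ∂P = 0) (hi : iIndepFun ξ P) :
    Submartingale (fun N w => ‖∑ j ∈ Finset.range (N + 1), ξ j w‖ ^ 2)
      (Filtration.natural ξ hm) P := by
  refine submartingale_of_setIntegral_le_succ
    (fun N => (stronglyMeasurable_sum_range_natural hm N).norm.pow 2)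
    (fun N => (memLp_finsetSum _ fun j _ => hL j).integrable_norm_pow two_ne_zero)
    (fun N s hs => ?_)
  rw [setIntegral_norm_sum_range_succ_sq hm hL h0 hi N hs]
  exact le_add_of_nonneg_right (integral_nonneg fun _ => sq_nonneg _)

theorem integral_norm_sum_range_sq (hm : ∀ j, StronglyMeasurable (ξ j))
    (hL : ∀ j, MemLp (ξ j) 2 P) (h0 : ∀ j, ∫ w, ξ j w ∂P = 0) (hi : iIndepFun ξ P) (N : ℕ) :
    ∫ w, ‖∑ j ∈ Finset.range (N + 1), ξ j w‖ ^ 2 ∂P =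
      ∑ j ∈ Finset.range (N + 1), ∫ w, ‖ξ j w‖ ^ 2 ∂P := by
  induction N with
  | zero => simp
  | succ N ih =>
    have hsucc := setIntegral_norm_sum_range_succ_sq hm hL h0 hi N MeasurableSet.univ
    simp only [Measure.restrict_univ] at hsucc
    rw [hsucc, ih, Finset.sum_range_succ _ (N + 1)]

theorem kolmogorov_maximal_inequality (hm : ∀ j, StronglyMeasurable (ξ j))
    (hL : ∀ j, MemLp (ξ j) 2 P) (h0 : ∀ j, ∫ w, ξ j w ∂P = 0) (hi : iIndepFun ξ P)
    (ε : NNReal) (N : ℕ) :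
    ε * P {w | ∃ k ≤ N, (ε : ℝ) ≤ ‖∑ j ∈ Finset.range (k + 1), ξ j w‖ ^ 2} ≤
      ENNReal.ofReal (∑ j ∈ Finset.range (N + 1), ∫ w, ‖ξ j w‖ ^ 2 ∂P) := by
  have hset : {w | ∃ k ≤ N, (ε : ℝ) ≤ ‖∑ j ∈ Finset.range (k + 1), ξ j w‖ ^ 2} =
      {w | (ε : ℝ) ≤ (Finset.range (N + 1)).sup' Finset.nonempty_range_add_one
        fun k => ‖∑ j ∈ Finset.range (k + 1), ξ j w‖ ^ 2} := by
    ext w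
    simp [Finset.le_sup'_iff]
  rw [hset, ← integral_norm_sum_range_sq hm hL h0 hi]
  refine (maximal_ineq (submartingale_norm_sum_range_sq hm hL h0 hi)
    (fun _ _ => sq_nonneg _) N).trans (ENNReal.ofReal_le_ofReal ?_)
  exact setIntegral_le_integral
    ((memLp_finsetSum _ fun j _ => hL j).integrable_norm_pow two_ne_zero)
    (.of_forall fun _ => sq_nonneg _)

theorem mul_measure_exists_le_norm_sum_range_sq (hm : ∀ j, StronglyMeasurable (ξ j))
    (hL : ∀ j, MemLp (ξ j) 2 P) (h0 : ∀ j, ∫ w, ξ j w ∂P = 0) (hi : iIndepFun ξ P)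
    (hs : Summable fun j => ∫ w, ‖ξ j w‖ ^ 2 ∂P) (ε : NNReal) :
    ε * P {w | ∃ k, (ε : ℝ) ≤ ‖∑ j ∈ Finset.range (k + 1), ξ j w‖ ^ 2} ≤
      ENNReal.ofReal (∑' j, ∫ w, ‖ξ j w‖ ^ 2 ∂P) := by
  have hmono : Monotone fun N => {w | ∃ k ≤ N, (ε : ℝ) ≤
      ‖∑ j ∈ Finset.range (k + 1), ξ j w‖ ^ 2} := fun N N' h w ⟨k, hk, hw⟩ => ⟨k, hk.trans h, hw⟩
  have hunion : {w | ∃ k, (ε : ℝ) ≤ ‖∑ j ∈ Finset.range (k + 1), ξ j w‖ ^ 2} =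
      ⋃ N, {w | ∃ k ≤ N, (ε : ℝ) ≤ ‖∑ j ∈ Finset.range (k + 1), ξ j w‖ ^ 2} := by
    ext w
    simp only [mem_ofPred_eq, mem_iUnion]
    exact ⟨fun ⟨k, h⟩ => ⟨k, k, le_rfl, h⟩, fun ⟨_, k, _, h⟩ => ⟨k, h⟩⟩
  rw [hunion, hmono.measure_iUnion, ENNReal.mul_iSup]
  exact iSup_le fun N => (kolmogorov_maximal_inequality hm hL h0 hi ε N).trans <|
    ENNReal.ofReal_le_ofReal <| hs.sum_le_tsum _ fun _ _ => integral_nonneg fun _ => sq_nonneg _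

theorem ae_exists_forall_norm_sum_range_sq_lt (hm : ∀ j, StronglyMeasurable (ξ j))
    (hL : ∀ j, MemLp (ξ j) 2 P) (h0 : ∀ j, ∫ w, ξ j w ∂P = 0) (hi : iIndepFun ξ P)
    (hs : Summable fun j => ∫ w, ‖ξ j w‖ ^ 2 ∂P) {ε : NNReal} (hε : ε ≠ 0) :
    ∀ᵐ w ∂P, ∃ m, ∀ k, ‖∑ j ∈ Finset.range (k + 1), ξ (m + j) w‖ ^ 2 < ε := by
  have hbound (m : ℕ) : ε * P {w | ¬∃ m, ∀ k, ‖∑ j ∈ Finset.range (k + 1), ξ (m + j) w‖ ^ 2 < ε} ≤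
      ENNReal.ofReal (∑' j, ∫ w, ‖ξ (m + j) w‖ ^ 2 ∂P) := by
    refine le_trans ?_ (mul_measure_exists_le_norm_sum_range_sq (fun j => hm (m + j))
      (fun j => hL _) (fun j => h0 _) (hi.precomp (add_right_injective m))
      (hs.comp_injective (add_right_injective m)) ε)
    gcongr
    intro hw
    push Not at hw
    exact hw m
  have hlim : Tendsto (fun m => ENNReal.ofReal (∑' j, ∫ w, ‖ξ (m + j) w‖ ^ 2 ∂P)) atTop (𝓝 0) := by
    simpa [add_comm] using
      ENNReal.tendsto_ofReal (tendsto_sum_nat_add fun j => ∫ w, ‖ξ j w‖ ^ 2 ∂P)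
  have hzero := ge_of_tendsto' hlim hbound
  rwa [nonpos_iff_eq_zero, mul_eq_zero, or_iff_right (ENNReal.coe_ne_zero.2 hε)] at hzero

theorem ae_cauchySeq_sum_range_of_iIndepFun (hL : ∀ j, MemLp (ξ j) 2 P)
    (h0 : ∀ j, ∫ w, ξ j w ∂P = 0) (hi : iIndepFun ξ P)
    (hs : Summable fun j => ∫ w, ‖ξ j w‖ ^ 2 ∂P) :
    ∀ᵐ w ∂P, CauchySeq fun N => ∑ j ∈ Finset.range N, ξ j w := by
  have heq (j : ℕ) : ξ j =ᵐ[P] (hL j).1.mk := (hL j).1.ae_eq_mk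
  have hs' : Summable fun j => ∫ w, ‖(hL j).1.mk (ξ j) w‖ ^ 2 ∂P := by
    refine hs.congr fun j => integral_congr_ae ?_
    filter_upwards [heq j] with w hw
    rw [hw]
  have hsmall (p : ℕ) := ae_exists_forall_norm_sum_range_sq_lt
    (fun j => (hL j).1.stronglyMeasurable_mk) (fun j => (hL j).ae_eq (heq j))
    (fun j => (integral_congr_ae (heq j)).symm.trans (h0 j)) (hi.congr heq) hs'
    (show 1 / ((p : NNReal) + 1) ≠ 0 by positivity)
  filter_upwards [ae_all_iff.2 hsmall, ae_all_iff.2 heq] with w hw hw'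
  simp only [hw']
  exact cauchySeq_sum_range_of_forall_exists fun p => by simpa using hw p

end RandomSeries

theorem ae_cauchySeq_sum_range_smul {𝕜 G Ω : Type*} [RCLike 𝕜] [NormedAddCommGroup G]
    [InnerProductSpace 𝕜 G] [CompleteSpace G] [MeasurableSpace Ω] {P : Measure Ω}
    [IsProbabilityMeasure P] {η : ℕ → Ω → 𝕜} {σ : ℝ} {v : ℕ → G} (hL : ∀ j, MemLp (η j) 2 P)
    (h0 : ∀ j, ∫ w, η j w ∂P = 0) (hi : iIndepFun η P) (hσ : ∀ j, ∫ w, ‖η j w‖ ^ 2 ∂P ≤ σ)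
    (hv : Summable fun j => ‖v j‖ ^ 2) :
    ∀ᵐ w ∂P, CauchySeq fun N => ∑ j ∈ Finset.range N, η j w • v j := by
  borelize G
  let _ : InnerProductSpace ℝ G := InnerProductSpace.rclikeToReal 𝕜 G
  have hnorm (j : ℕ) : ∫ w, ‖η j w • v j‖ ^ 2 ∂P = (∫ w, ‖η j w‖ ^ 2 ∂P) * ‖v j‖ ^ 2 := by
    simp only [norm_smul, mul_pow, integral_mul_const]
  refine ae_cauchySeq_sum_range_of_iIndepFun
    (fun j => (memLp_top_const (v j)).smul (hL j)) (fun j => ?_)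
    (hi.comp (fun j z => z • v j) fun j => by fun_prop) ?_
  · rw [integral_smul_const, h0, zero_smul]
  · refine Summable.of_nonneg_of_le (fun j => integral_nonneg fun _ => sq_nonneg _)
      (fun j => ?_) (hv.mul_left σ)
    rw [hnorm]
    gcongr
    exact hσ j

theorem cauchySeq_of_dist_le_mul {α β : Type*} [PseudoMetricSpace α] [PseudoMetricSpace β]
    {u : ℕ → α} {v : ℕ → β} {C : ℝ} (huv : ∀ m n, dist (u m) (u n) ≤ C * dist (v m) (v n))
    (hv : CauchySeq v) : CauchySeq u := by
  rw [cauchySeq_iff_tendsto_dist_atTop_0] at hv ⊢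
  exact squeeze_zero (fun _ => dist_nonneg) (fun q => huv q.1 q.2) (by simpa using hv.const_mul C)

/-! ### Functionals and orthonormal bases -/

section Parseval

variable {𝕜 H ι : Type*} [RCLike 𝕜] [SeminormedAddCommGroup H] [InnerProductSpace 𝕜 H] {S : ι → H}

theorem norm_sum_smul_sq_of_orthonormal (hS : Orthonormal 𝕜 S) (c : ι → 𝕜) (F : Finset ι) :
    ‖∑ j ∈ F, c j • S j‖ ^ 2 = ∑ j ∈ F, ‖c j‖ ^ 2 := by
  rw [@norm_sq_eq_re_inner 𝕜, hS.inner_sum c c F, map_sum]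
  refine Finset.sum_congr rfl fun j _ => ?_
  rw [RCLike.conj_mul, ← RCLike.ofReal_pow, RCLike.ofReal_re]

theorem sum_norm_apply_sq_le_of_orthonormal (hS : Orthonormal 𝕜 S) (f : StrongDual 𝕜 H)
    (F : Finset ι) : ∑ j ∈ F, ‖f (S j)‖ ^ 2 ≤ ‖f‖ ^ 2 := by
  set A := ∑ j ∈ F, ‖f (S j)‖ ^ 2 with hA
  have hA0 : 0 ≤ A := Finset.sum_nonneg fun _ _ => sq_nonneg _
  have hnorm : ‖∑ j ∈ F, conj (f (S j)) • S j‖ ^ 2 = A := by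
    simpa only [RCLike.norm_conj] using
      norm_sum_smul_sq_of_orthonormal hS (fun j => conj (f (S j))) F
  have happly : f (∑ j ∈ F, conj (f (S j)) • S j) = (A : 𝕜) := by
    simp only [map_sum, map_smul, smul_eq_mul, RCLike.conj_mul, hA, RCLike.ofReal_pow]
  have hle : A ^ 2 ≤ ‖f‖ ^ 2 * A := by
    rw [← hnorm, ← mul_pow, hnorm]
    refine pow_le_pow_left₀ hA0 ?_ 2
    simpa only [happly, RCLike.norm_of_nonneg hA0] using
      f.le_opNorm (∑ j ∈ F, conj (f (S j)) • S j)
  rcases hA0.eq_or_lt with h0 | h0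
  · exact h0 ▸ sq_nonneg ‖f‖
  · exact le_of_mul_le_mul_right (by rwa [sq] at hle) h0

theorem summable_norm_apply_sq_of_orthonormal (hS : Orthonormal 𝕜 S) (f : StrongDual 𝕜 H) :
    Summable fun j => ‖f (S j)‖ ^ 2 :=
  summable_of_sum_le (fun _ => sq_nonneg _) (sum_norm_apply_sq_le_of_orthonormal hS f)

theorem opNorm_le_of_forall_sum_norm_apply_sq_le (hS : Orthonormal 𝕜 S)
    (hd : Dense (Submodule.span 𝕜 (range S) : Set H)) {f : StrongDual 𝕜 H} {B : ℝ} (hB0 : 0 ≤ B)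
    (hB : ∀ F : Finset ι, ∑ j ∈ F, ‖f (S j)‖ ^ 2 ≤ B ^ 2) : ‖f‖ ≤ B := by
  refine f.opNorm_le_bound hB0 fun s => ?_
  refine (isClosed_le f.continuous.norm (continuous_const.mul continuous_norm)).closure_subset_iff.2
    (fun s hs => ?_) (hd s)
  obtain ⟨c, rfl⟩ := Finsupp.mem_span_range_iff_exists_finsupp.1 hs
  simp only [Finsupp.sum, mem_ofPred_eq, map_sum, map_smul, smul_eq_mul]
  refine le_of_sq_le_sq ?_ (mul_nonneg hB0 (norm_nonneg _))
  calc ‖∑ j ∈ c.support, c j * f (S j)‖ ^ 2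
      ≤ (∑ j ∈ c.support, ‖c j‖ * ‖f (S j)‖) ^ 2 := by
        gcongr
        exact (norm_sum_le _ _).trans_eq (by simp only [norm_mul])
    _ ≤ (∑ j ∈ c.support, ‖c j‖ ^ 2) * ∑ j ∈ c.support, ‖f (S j)‖ ^ 2 :=
        Finset.sum_mul_sq_le_sq_mul_sq _ _ _
    _ ≤ (∑ j ∈ c.support, ‖c j‖ ^ 2) * B ^ 2 := by
        gcongr
        exact hB _
    _ = (B * ‖∑ j ∈ c.support, c j • S j‖) ^ 2 := by
        rw [mul_pow, norm_sum_smul_sq_of_orthonormal hS, mul_comm]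

theorem hasSum_norm_apply_sq_of_orthonormal (hS : Orthonormal 𝕜 S)
    (hd : Dense (Submodule.span 𝕜 (range S) : Set H)) (f : StrongDual 𝕜 H) :
    HasSum (fun j => ‖f (S j)‖ ^ 2) (‖f‖ ^ 2) := by
  have hsum := summable_norm_apply_sq_of_orthonormal hS f
  have hnn : 0 ≤ ∑' j, ‖f (S j)‖ ^ 2 := tsum_nonneg fun _ => sq_nonneg _
  refine hsum.hasSum_iff.2 (le_antisymm ?_ ?_)
  · exact hsum.tsum_le_of_sum_le (sum_norm_apply_sq_le_of_orthonormal hS f)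
  · refine (Real.le_sqrt (norm_nonneg _) hnn).1 <|
      opNorm_le_of_forall_sum_norm_apply_sq_le hS hd (Real.sqrt_nonneg _) fun F => ?_
    rw [Real.sq_sqrt hnn]
    exact hsum.sum_le_tsum F fun _ _ => sq_nonneg _

end Parseval

/-! ### Characteristic functionals -/

section CharacteristicFunctional

theorem measure_ext_of_map_eq_of_isInducing {E B : Type*} [TopologicalSpace E] [MeasurableSpace E]
    [BorelSpace E] [TopologicalSpace B] [MeasurableSpace B] [BorelSpace B] {R : E → B}
    (hR : Topology.IsInducing R) {μ ν : Measure E} (hμν : μ.map R = ν.map R) : μ = ν := by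
  refine Measure.ext fun A hA => ?_
  have hcomap : ‹MeasurableSpace E› = MeasurableSpace.comap R ‹MeasurableSpace B› := by
    rw [BorelSpace.measurable_eq (α := B), ← borel_comap, ← hR.eq_induced,
      BorelSpace.measurable_eq (α := E)]
  obtain ⟨A', hA', rfl⟩ : MeasurableSet[MeasurableSpace.comap R ‹MeasurableSpace B›] A :=
    hcomap ▸ hA
  have hRm : Measurable R := hR.continuous.measurable
  rw [← Measure.map_apply hRm hA', ← Measure.map_apply hRm hA', hμν]

theorem measure_pi_ext_of_integral_exp_re {ι : Type*} {B : ι → Type*}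
    [∀ i, NormedAddCommGroup (B i)] [∀ i, NormedSpace ℂ (B i)] [∀ i, CompleteSpace (B i)]
    [∀ i, SecondCountableTopology (B i)] [∀ i, MeasurableSpace (B i)] [∀ i, BorelSpace (B i)]
    {μ ν : Measure (∀ i, B i)} [IsFiniteMeasure μ] [IsFiniteMeasure ν]
    (hμν : ∀ l : (∀ i, B i) →L[ℂ] ℂ, ∫ v, Complex.exp ((l v).re * Complex.I) ∂μ =
      ∫ v, Complex.exp ((l v).re * Complex.I) ∂ν) : μ = ν := by
  refine IsProjectiveLimit.unique (P := fun I => ν.map I.restrict) (fun I => ?_) (fun I => rfl)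
  refine Measure.ext_of_charFunDual (funext fun f => ?_)
  have hm : Measurable (I.restrict : (∀ i, B i) → _) := Finset.measurable_restrict I
  have hre (v : ∀ i, B i) : f (I.restrict v) = (f.extendRCLike (𝕜 := ℂ) (I.restrict v)).re :=
    (StrongDual.re_extendRCLike_apply (𝕜 := ℂ) f _).symm
  rw [charFunDual_apply, charFunDual_apply,
    integral_map hm.aemeasurable (Continuous.aestronglyMeasurable (by fun_prop)),
    integral_map hm.aemeasurable (Continuous.aestronglyMeasurable (by fun_prop))]
  simp only [hre]
  exact hμν ((f.extendRCLike (𝕜 := ℂ)).comp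
    (ContinuousLinearMap.pi fun i : I => ContinuousLinearMap.proj (i : ι)))

theorem measure_ext_of_integral_exp_re {E ι : Type*} [AddCommGroup E] [Module ℂ E]
    [TopologicalSpace E] [MeasurableSpace E] [BorelSpace E] [Countable ι] {B : ι → Type*}
    [∀ i, NormedAddCommGroup (B i)] [∀ i, NormedSpace ℂ (B i)] [∀ i, CompleteSpace (B i)]
    [∀ i, SecondCountableTopology (B i)] {R : ∀ i, E →L[ℂ] B i}
    (hR : Topology.IsInducing fun x i => R i x) {μ ν : Measure E} [IsFiniteMeasure μ]
    [IsFiniteMeasure ν]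
    (hμν : ∀ l : E →L[ℂ] ℂ, ∫ x, Complex.exp ((l x).re * Complex.I) ∂μ =
      ∫ x, Complex.exp ((l x).re * Complex.I) ∂ν) : μ = ν := by
  let _ (i : ι) : MeasurableSpace (B i) := borel (B i)
  have _ (i : ι) : BorelSpace (B i) := ⟨rfl⟩
  refine measure_ext_of_map_eq_of_isInducing hR (measure_pi_ext_of_integral_exp_re fun l => ?_)
  have hRm : Measurable fun x i => R i x := hR.continuous.measurable
  rw [integral_map hRm.aemeasurable (Continuous.aestronglyMeasurable (by fun_prop)),
    integral_map hRm.aemeasurable (Continuous.aestronglyMeasurable (by fun_prop))]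
  exact hμν (l.comp (ContinuousLinearMap.pi R))

end CharacteristicFunctional

/-! ### Gaussian series -/

section GaussianSeries

theorem integral_exp_re_mul_stdComplexGaussian (a : ℂ) :
    ∫ z, Complex.exp ((z * a).re * Complex.I) ∂stdComplexGaussian =
      Complex.exp (-(‖a‖ ^ 2 / 4 : ℝ)) := by
  have hre (p : ℝ × ℝ) : ((((p.1 : ℂ) + Complex.I * p.2) / (Real.sqrt 2 : ℂ) * a).re : ℂ) =
      (a.re / Real.sqrt 2 : ℝ) * p.1 + (-a.im / Real.sqrt 2 : ℝ) * p.2 := by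
    rw [Complex.mul_re, Complex.div_ofReal_re, Complex.div_ofReal_im]
    simp only [Complex.add_re, Complex.ofReal_re, Complex.mul_re, Complex.I_re, zero_mul,
      Complex.I_im, Complex.ofReal_im, mul_zero, sub_self, add_zero, Complex.add_im,
      Complex.mul_im, one_mul, zero_add, Complex.ofReal_sub, Complex.ofReal_mul,
      Complex.ofReal_div, Complex.ofReal_neg]
    ring
  have hsq : (a.re / Real.sqrt 2) ^ 2 + (-a.im / Real.sqrt 2) ^ 2 = ‖a‖ ^ 2 / 2 := by
    rw [div_pow, div_pow, Real.sq_sqrt zero_le_two, Complex.sq_norm, Complex.normSq_apply]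
    ring
  rw [stdComplexGaussian, integral_map (by fun_prop)
    (Continuous.aestronglyMeasurable (by fun_prop))]
  simp only [hre, add_mul, Complex.exp_add]
  rw [integral_prod_mul (fun x : ℝ => Complex.exp ((a.re / Real.sqrt 2 : ℝ) * x * Complex.I))
    (fun x : ℝ => Complex.exp ((-a.im / Real.sqrt 2 : ℝ) * x * Complex.I)),
    ← charFun_apply_real, ← charFun_apply_real, charFun_gaussianReal, charFun_gaussianReal,
    ← Complex.exp_add]
  congr 1
  have hsq' := congrArg (fun x : ℝ => (x : ℂ)) hsq
  push_cast at hsq' ⊢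
  linear_combination -hsq' / 2

variable {Ω ι : Type*} [MeasurableSpace Ω] {P : Measure Ω} {η : ι → Ω → ℂ}

theorem integral_exp_re_sum_mul_of_isIIDStdComplexGaussian (hη : IsIIDStdComplexGaussian η P)
    (a : ι → ℂ) (F : Finset ι) :
    ∫ w, Complex.exp ((∑ j ∈ F, η j w * a j).re * Complex.I) ∂P =
      Complex.exp (-((∑ j ∈ F, ‖a j‖ ^ 2) / 4 : ℝ)) := by
  let g (j : F) (z : ℂ) : ℂ := Complex.exp ((z * a j).re * Complex.I)
  have hg (j : F) : Continuous (g j) := by fun_prop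
  have hm (j : F) : AEMeasurable (η j) P := (hη.law j).aemeasurable
  have hmarginal (j : F) : ∫ w, g j (η j w) ∂P = Complex.exp (-(‖a j‖ ^ 2 / 4 : ℝ)) := by
    rw [← integral_exp_re_mul_stdComplexGaussian, ← (hη.law j).map_eq,
      integral_map (hm j) (hg j).aestronglyMeasurable]
  calc ∫ w, Complex.exp ((∑ j ∈ F, η j w * a j).re * Complex.I) ∂P
      = ∫ w, ∏ j : F, g j (η j w) ∂P := by
        refine integral_congr_ae (.of_forall fun w => ?_)
        simp only [g]
        rw [← Complex.exp_sum, ← Finset.sum_mul, ← Complex.ofReal_sum, ← Complex.re_sum,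
          Finset.sum_coe_sort F fun j => η j w * a j]
    _ = ∏ j : F, ∫ w, g j (η j w) ∂P :=
        ((hη.indep.precomp Subtype.val_injective).comp g
          fun j => (hg j).measurable).integral_fun_prod_eq_prod_integral
          fun j => (hg j).comp_aestronglyMeasurable (hm j).aestronglyMeasurable
    _ = Complex.exp (-((∑ j ∈ F, ‖a j‖ ^ 2) / 4 : ℝ)) := by
        simp only [hmarginal]
        rw [← Complex.exp_sum, Finset.sum_coe_sort F fun j => (-((‖a j‖ ^ 2 / 4 : ℝ) : ℂ)),
          Finset.sum_neg_distrib, ← Complex.ofReal_sum, Finset.sum_div]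

theorem aemeasurable_sum_smul {E : Type*} [AddCommMonoid E] [Module ℂ E] [TopologicalSpace E]
    [ContinuousAdd E] [ContinuousSMul ℂ E] [MeasurableSpace E] [BorelSpace E]
    (hη : ∀ j, AEMeasurable (η j) P) (v : ι → E) (F : Finset ι) :
    AEMeasurable (fun w => ∑ j ∈ F, η j w • v j) P := by
  have hcont : Continuous fun c : F → ℂ => ∑ j : F, c j • v j := by fun_prop
  refine (hcont.measurable.comp_aemeasurable (aemeasurable_pi_lambda _ fun j => hη j)).congr
    (.of_forall fun w => ?_)
  exact Finset.sum_coe_sort F fun j => η j w • v j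

variable {H E : Type*} [SeminormedAddCommGroup H] [InnerProductSpace ℂ H] [AddCommGroup E]
  [Module ℂ E] [TopologicalSpace E] {S : ι → H} {T : H →L[ℂ] E} {F : ℕ → Finset ι} {ψ : Ω → E}

theorem integral_exp_re_of_tendsto_sum_smul [IsFiniteMeasure P] (hS : Orthonormal ℂ S)
    (hd : Dense (Submodule.span ℂ (range S) : Set H)) (hη : IsIIDStdComplexGaussian η P)
    (hF : Tendsto F atTop atTop)
    (hψ : ∀ᵐ w ∂P, Tendsto (fun N => ∑ j ∈ F N, η j w • T (S j)) atTop (𝓝 (ψ w)))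
    (l : E →L[ℂ] ℂ) :
    ∫ w, Complex.exp ((l (ψ w)).re * Complex.I) ∂P =
      Complex.exp (-(‖l.comp T‖ ^ 2 / 4 : ℝ)) := by
  have hl (w : Ω) (N : ℕ) :
      l (∑ j ∈ F N, η j w • T (S j)) = ∑ j ∈ F N, η j w * l.comp T (S j) := by
    simp only [map_sum, map_smul, smul_eq_mul, ContinuousLinearMap.comp_apply]
  have hexp : Continuous fun z : ℂ => Complex.exp (z.re * Complex.I) := by fun_prop
  have hint : Tendsto (fun N => ∫ w, Complex.exp
      ((∑ j ∈ F N, η j w * l.comp T (S j)).re * Complex.I) ∂P) atTop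
      (𝓝 (∫ w, Complex.exp ((l (ψ w)).re * Complex.I) ∂P)) := by
    refine tendsto_integral_of_dominated_convergence (fun _ => 1) (fun N => ?_)
      (integrable_const _) (fun N => .of_forall fun w => (Complex.norm_exp_ofReal_mul_I _).le) ?_
    · exact hexp.comp_aestronglyMeasurable
        (aemeasurable_sum_smul (fun j => (hη.law j).aemeasurable) _ _).aestronglyMeasurable
    · filter_upwards [hψ] with w hw
      simp only [← hl]
      exact ((hexp.comp l.continuous).tendsto _).comp hw
  simp only [integral_exp_re_sum_mul_of_isIIDStdComplexGaussian hη] at hint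
  have hcont : Continuous fun x : ℝ => Complex.exp (-(x / 4 : ℝ)) := by fun_prop
  exact tendsto_nhds_unique hint ((hcont.tendsto _).comp
    ((hasSum_norm_apply_sq_of_orthonormal hS hd (l.comp T)).comp hF))

theorem identDistrib_of_tendsto_sum_smul [IsFiniteMeasure P] [ContinuousAdd E]
    [ContinuousSMul ℂ E] [MeasurableSpace E] [BorelSpace E] {κ : Type*} [Countable κ]
    {B : κ → Type*} [∀ i, NormedAddCommGroup (B i)] [∀ i, NormedSpace ℂ (B i)]
    [∀ i, CompleteSpace (B i)] [∀ i, SecondCountableTopology (B i)] {R : ∀ i, E →L[ℂ] B i}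
    (hR : Topology.IsInducing fun x i => R i x) {ι' Ω' : Type*} [MeasurableSpace Ω']
    {P' : Measure Ω'} [IsFiniteMeasure P'] {η' : ι' → Ω' → ℂ} {S' : ι' → H}
    {F' : ℕ → Finset ι'} {ψ' : Ω' → E}
    (hS : Orthonormal ℂ S) (hd : Dense (Submodule.span ℂ (range S) : Set H))
    (hη : IsIIDStdComplexGaussian η P) (hF : Tendsto F atTop atTop)
    (hψ : ∀ᵐ w ∂P, Tendsto (fun N => ∑ j ∈ F N, η j w • T (S j)) atTop (𝓝 (ψ w)))
    (hS' : Orthonormal ℂ S') (hd' : Dense (Submodule.span ℂ (range S') : Set H))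
    (hη' : IsIIDStdComplexGaussian η' P') (hF' : Tendsto F' atTop atTop)
    (hψ' : ∀ᵐ w ∂P', Tendsto (fun N => ∑ j ∈ F' N, η' j w • T (S' j)) atTop (𝓝 (ψ' w))) :
    IdentDistrib ψ ψ' P P' := by
  have := hR.pseudoMetrizableSpace
  have hm : AEMeasurable ψ P := aemeasurable_of_tendsto_metrizable_ae atTop
    (fun N => aemeasurable_sum_smul (fun j => (hη.law j).aemeasurable) _ (F N)) hψ
  have hm' : AEMeasurable ψ' P' := aemeasurable_of_tendsto_metrizable_ae atTop
    (fun N => aemeasurable_sum_smul (fun j => (hη'.law j).aemeasurable) _ (F' N)) hψ'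
  refine ⟨hm, hm', measure_ext_of_integral_exp_re hR fun l => ?_⟩
  rw [integral_map hm (Continuous.aestronglyMeasurable (by fun_prop)),
    integral_map hm' (Continuous.aestronglyMeasurable (by fun_prop)),
    integral_exp_re_of_tendsto_sum_smul hS hd hη hF hψ,
    integral_exp_re_of_tendsto_sum_smul hS' hd' hη' hF' hψ']

end GaussianSeries

/-! ### Continuous functions in `L²` -/

section ContinuousL2

theorem norm_le_sqrt_mul_of_enorm_sq_le {E F : Type*} [SeminormedAddCommGroup E]
    [SeminormedAddCommGroup F] {a : E} {b : F} {C : NNReal} (h : ‖a‖ₑ ^ 2 ≤ C * ‖b‖ₑ ^ 2) :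
    ‖a‖ ≤ NNReal.sqrt C * ‖b‖ := by
  rw [enorm_eq_nnnorm, enorm_eq_nnnorm] at h
  norm_cast at h
  refine NNReal.coe_le_coe.2 (?_ : ‖a‖₊ ≤ NNReal.sqrt C * ‖b‖₊)
  rwa [← pow_le_pow_iff_left₀ zero_le zero_le two_ne_zero, mul_pow, NNReal.sq_sqrt]

variable {𝕜 K : Type*} [RCLike 𝕜] [TopologicalSpace K] [CompactSpace K] [MeasurableSpace K]
  [BorelSpace K] {μ : Measure K} [IsFiniteMeasure μ]

theorem enorm_toLp_sq {E : Type*} [NormedAddCommGroup E] [NormedSpace 𝕜 E]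
    [SecondCountableTopologyEither K E] (f : C(K, E)) :
    ‖ContinuousMap.toLp 2 μ 𝕜 f‖ₑ ^ 2 = ∫⁻ x, ‖f x‖ₑ ^ 2 ∂μ := by
  have hpow := eLpNorm_nnreal_pow_eq_lintegral (f := f) (μ := μ) (p := 2) two_ne_zero
  simp only [NNReal.coe_ofNat, ENNReal.rpow_ofNat] at hpow
  rw [Lp.enorm_def, eLpNorm_congr_ae (ContinuousMap.coeFn_toLp (𝕜 := 𝕜) μ f)]
  exact hpow

variable {H ι : Type*} [SeminormedAddCommGroup H] [InnerProductSpace 𝕜 H] {S : ι → H}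

/-- Pointwise, Bessel's inequality bounds the kernel `∑ ‖T (S j) x‖²` by the squared norm of the
evaluation functional `f ↦ T f x`. -/
theorem summable_norm_toLp_sq_of_orthonormal (hS : Orthonormal 𝕜 S) (T : H →L[𝕜] C(K, 𝕜)) :
    Summable fun j => ‖ContinuousMap.toLp 2 μ 𝕜 (T (S j))‖ ^ 2 := by
  have hpoint (F : Finset ι) (x : K) : ∑ j ∈ F, ‖T (S j) x‖ₑ ^ 2 ≤ (‖T‖₊ ^ 2 : NNReal) := by
    have hx : ‖(ContinuousMap.evalCLM 𝕜 x).comp T‖ ≤ ‖T‖ :=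
      ContinuousLinearMap.opNorm_le_bound _ (norm_nonneg _) fun s =>
        ((T s).norm_coe_le_norm x).trans (T.le_opNorm s)
    have hBessel : ∑ j ∈ F, ‖T (S j) x‖ ^ 2 ≤ ‖T‖ ^ 2 :=
      (sum_norm_apply_sq_le_of_orthonormal hS ((ContinuousMap.evalCLM 𝕜 x).comp T) F).trans
        (by gcongr)
    simp only [← coe_nnnorm] at hBessel
    simp only [enorm_eq_nnnorm]
    exact_mod_cast hBessel
  obtain ⟨m, hm⟩ := ENNReal.canLift.prf (μ univ) (measure_ne_top μ univ)
  refine summable_of_sum_le (c := ‖T‖ ^ 2 * m) (fun _ => sq_nonneg _) fun F => ?_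
  have hint : ∑ j ∈ F, ‖ContinuousMap.toLp 2 μ 𝕜 (T (S j))‖ₑ ^ 2 ≤
      (‖T‖₊ ^ 2 : NNReal) * m := by
    simp only [enorm_toLp_sq]
    rw [hm, ← lintegral_finsetSum F fun j _ => by fun_prop]
    exact (lintegral_mono (hpoint F)).trans_eq (lintegral_const _)
  simp only [enorm_eq_nnnorm] at hint
  simp only [← coe_nnnorm]
  exact_mod_cast hint

theorem ae_cauchySeq_sum_range_smul_toLp {S : ℕ → H} (hS : Orthonormal 𝕜 S)
    (T : H →L[𝕜] C(K, 𝕜)) {Ω : Type*} [MeasurableSpace Ω] {P : Measure Ω}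
    [IsProbabilityMeasure P] {η : ℕ → Ω → 𝕜} {σ : ℝ} (hL : ∀ j, MemLp (η j) 2 P)
    (h0 : ∀ j, ∫ w, η j w ∂P = 0) (hi : iIndepFun η P) (hσ : ∀ j, ∫ w, ‖η j w‖ ^ 2 ∂P ≤ σ) :
    ∀ᵐ w ∂P, CauchySeq fun N =>
      ContinuousMap.toLp 2 μ 𝕜 (∑ j ∈ Finset.range N, η j w • T (S j)) := by
  simp only [map_sum, map_smul]
  exact ae_cauchySeq_sum_range_smul hL h0 hi hσ (summable_norm_toLp_sq_of_orthonormal hS T)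

end ContinuousL2

/-! ### The volume measure in a chart -/

section VolumeDensity

variable {n : ℕ} {X : Type*} [TopologicalSpace X] [ChartedSpace (EuclideanSpace ℂ (Fin n)) X]

local notation "ℂⁿ" => EuclideanSpace ℂ (Fin n)

lemma chartVec_injective [IsManifold 𝓘(ℂ, ℂⁿ) ω X] {φ : OpenPartialHomeomorph X ℂⁿ}
    (hφ : φ ∈ atlas ℂⁿ X) {z : ℂⁿ} (hz : z ∈ φ.target) :
    Function.Injective (chartVec φ z) := by
  have : IsManifold 𝓘(ℂ, ℂⁿ) 1 X := .of_le (n := ω) le_top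
  exact (mdifferentiable_of_mem_atlas hφ).symm.mfderiv_injective hz

namespace HermitianForm

variable (Θ : HermitianForm n X)

lemma metric_comm (x : X) (u v : TangentSpace 𝓘(ℂ, ℂⁿ) x) :
    Θ.metric x u v = Θ.metric x v u := by
  have halt : (Θ.form x).IsAlt := Θ.alternating x
  rw [metric, metric, ← Θ.invariant, smul_smul, Complex.I_mul_I, neg_one_smul, map_neg, halt.neg]

/-- The Riemannian metric `g` at the point with coordinates `z` in the chart `φ`, as a real
bilinear form on coordinate vectors. -/
def chartMetric (φ : OpenPartialHomeomorph X ℂⁿ) (z : ℂⁿ) : LinearMap.BilinForm ℝ ℂⁿ :=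
  let A : ℂⁿ →L[ℝ] TangentSpace 𝓘(ℂ, ℂⁿ) (φ.symm z) := (chartVec φ z).restrictScalars ℝ
  (Θ.form (φ.symm z)).compl₁₂ A.toLinearMap
    (A ∘L (Complex.I • ContinuousLinearMap.id ℂ ℂⁿ).restrictScalars ℝ).toLinearMap

lemma chartMetric_apply (φ : OpenPartialHomeomorph X ℂⁿ) (z u v : ℂⁿ) :
    Θ.chartMetric φ z u v = Θ.metric (φ.symm z) (chartVec φ z u) (chartVec φ z v) := by
  simp [chartMetric, metric]

lemma posDef_chartMetric [IsManifold 𝓘(ℂ, ℂⁿ) ω X] {φ : OpenPartialHomeomorph X ℂⁿ}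
    (hφ : φ ∈ atlas ℂⁿ X) {z : ℂⁿ} (hz : z ∈ φ.target) :
    (Θ.chartMetric φ z).toQuadraticMap.PosDef := by
  intro v hv
  rw [LinearMap.BilinMap.toQuadraticMap_apply, chartMetric_apply]
  exact Θ.positive _ _ ((map_ne_zero_iff (chartVec φ z) (chartVec_injective hφ hz)).2 hv)

theorem volDensity_pos [IsManifold 𝓘(ℂ, ℂⁿ) ω X] {φ : OpenPartialHomeomorph X ℂⁿ}
    (hφ : φ ∈ atlas ℂⁿ X) {z : ℂⁿ} (hz : z ∈ φ.target) : 0 < Θ.volDensity φ z := by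
  obtain ⟨b, hb⟩ := exists_basis n
  have hsymm : (Θ.chartMetric φ z).IsSymm :=
    ⟨fun u v => by simp only [chartMetric_apply, Θ.metric_comm]⟩
  have hgram : LinearMap.BilinForm.toMatrix b (Θ.chartMetric φ z) =
      Matrix.of fun i j => Θ.metric (φ.symm z) (chartVec φ z (coordFrame n i))
        (chartVec φ z (coordFrame n j)) := by
    ext i j
    rw [LinearMap.BilinForm.toMatrix_apply, hb, chartMetric_apply, Matrix.of_apply]
  rw [volDensity, ← hgram]
  exact Real.sqrt_pos.2 ((LinearMap.BilinForm.posDef_toQuadraticMap_iff_matrix b _ hsymm).1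
    (Θ.posDef_chartMetric hφ hz)).det_pos

theorem setLIntegral_chart_source [IsManifold 𝓘(ℂ, ℂⁿ) ω X] [SecondCountableTopology X]
    [MeasurableSpace X] [BorelSpace X] {φ : OpenPartialHomeomorph X ℂⁿ}
    (hφ : φ ∈ atlas ℂⁿ X) {f : X → ℝ≥0∞} (hf : Measurable f) :
    ∫⁻ x in φ.source, f x ∂Θ.vol =
      ∫⁻ z in φ.target, ENNReal.ofReal (Θ.volDensity φ z) * f (φ.symm z) := by
  have hφm : AEMeasurable φ.symm (volume.restrict φ.target) :=
    φ.continuousOn_symm.aemeasurable φ.open_target.measurableSet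
  have hdm : AEMeasurable (fun z => ENNReal.ofReal (Θ.volDensity φ z))
      (volume.restrict φ.target) :=
    ((Θ.continuousOn_volDensity hφ).aemeasurable φ.open_target.measurableSet).ennreal_ofReal
  rw [Θ.vol_restrict_source hφ, chartVol, lintegral_map' hf.aemeasurable
    (hφm.mono_ac (withDensity_absolutelyContinuous _ _))]
  exact lintegral_withDensity_eq_lintegral_mul₀ hdm (hf.comp_aemeasurable hφm)

end HermitianForm

end VolumeDensity

/-! ### Sections in coordinates -/

section Coordinates

variable {n : ℕ} {X : Type*} [TopologicalSpace X] [ChartedSpace (EuclideanSpace ℂ (Fin n)) X]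
  {L : X → Type*} [TopologicalSpace (TotalSpace ℂ L)] [∀ x, TopologicalSpace (L x)]
  [FiberBundle ℂ L]

local notation "ℂⁿ" => EuclideanSpace ℂ (Fin n)

variable (n L) in
/-- The part of the target of the preferred chart at `x₀` over which the preferred trivialization
of `L` at `x₀` is defined. -/
def coordDomain (x₀ : X) : Set ℂⁿ :=
  (chartAt ℂⁿ x₀).target ∩ (chartAt ℂⁿ x₀).symm ⁻¹' (trivializationAt ℂ L x₀).baseSet

lemma isOpen_coordDomain (x₀ : X) : IsOpen (coordDomain n L x₀) :=
  (chartAt ℂⁿ x₀).isOpen_inter_preimage_symm (trivializationAt ℂ L x₀).open_baseSet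

lemma chartAt_mem_coordDomain (x₀ : X) : chartAt ℂⁿ x₀ x₀ ∈ coordDomain n L x₀ := by
  refine ⟨mem_chart_target _ x₀, ?_⟩
  rw [mem_preimage, OpenPartialHomeomorph.left_inv _ (mem_chart_source _ x₀)]
  exact mem_baseSet_trivializationAt ℂ L x₀

variable (n L) in
/-- A compact set of coordinates, in the preferred chart at a point `center`, over which `L` is
trivialized. The topology of `H⁰(X, L)` is studied through the coordinate expressions of sections
on such sets. -/
structure CoordPatch where
  /-- the point at which the preferred chart and trivialization are taken -/
  center : X
  /-- the compact set of coordinates -/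
  compacts : TopologicalSpace.Compacts ℂⁿ
  subset_coordDomain : (compacts : Set ℂⁿ) ⊆ coordDomain n L center

namespace CoordPatch

variable (p : CoordPatch n L)

/-- The open set of the points of `X` whose coordinates lie in the interior of the compact set. -/
def nhd : Set X :=
  (chartAt ℂⁿ p.center).source ∩ chartAt ℂⁿ p.center ⁻¹' interior p.compacts

lemma isOpen_nhd : IsOpen p.nhd :=
  (chartAt ℂⁿ p.center).isOpen_inter_preimage isOpen_interior

variable (n L) in
lemma exists_mem_nhd (x : X) : ∃ p : CoordPatch n L, x ∈ p.nhd := by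
  obtain ⟨K, hK, hxK, hKL⟩ :=
    exists_compact_subset (isOpen_coordDomain x) (chartAt_mem_coordDomain (n := n) (L := L) x)
  exact ⟨⟨x, ⟨K, hK⟩, hKL⟩, mem_chart_source _ x, hxK⟩

variable (n L) in
lemma exists_countable_cover [SecondCountableTopology X] :
    ∃ t : Set (CoordPatch n L), t.Countable ∧ ∀ x, ∃ p ∈ t, x ∈ p.nhd := by
  choose p hp using exists_mem_nhd n L
  obtain ⟨s, hs, hsX⟩ := TopologicalSpace.countable_cover_nhds
    fun x : X => (p x).isOpen_nhd.mem_nhds (hp x)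
  refine ⟨p '' s, hs.image p, fun x => ?_⟩
  obtain ⟨y, hy, hxy⟩ := mem_iUnion₂.1 (hsX.symm.subset (mem_univ x))
  exact ⟨p y, mem_image_of_mem p hy, hxy⟩

lemma exists_subset_interior :
    ∃ q : CoordPatch n L, q.center = p.center ∧ (p.compacts : Set ℂⁿ) ⊆ interior q.compacts := by
  obtain ⟨K, hK, hpK, hKL⟩ := exists_compact_between p.compacts.isCompact
    (isOpen_coordDomain p.center) p.subset_coordDomain
  exact ⟨⟨p.center, ⟨K, hK⟩, hKL⟩, rfl, hpK⟩

lemma isCompact_image_symm : IsCompact ((chartAt ℂⁿ p.center).symm '' p.compacts) :=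
  p.compacts.isCompact.image_of_continuousOn
    ((chartAt ℂⁿ p.center).continuousOn_symm.mono fun _ hz => (p.subset_coordDomain hz).1)

end CoordPatch

variable [∀ x, AddCommGroup (L x)] [∀ x, Module ℂ (L x)] [VectorBundle ℂ ℂ L]

variable (n L) in
/-- The function `f` on `ℂⁿ` which describes a section `s = f e` of `L` in the preferred chart at
`x₀` and the frame `e` of `L` given by the preferred trivialization at `x₀`. It has the junk value
`0` outside the base set of the trivialization, which makes it linear in `s` everywhere. -/
def coord (x₀ : X) : (∀ x, L x) →ₗ[ℂ] ℂⁿ → ℂ :=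
  LinearMap.pi fun z => (trivializationAt ℂ L x₀).linearMapAt ℂ ((chartAt ℂⁿ x₀).symm z) ∘ₗ
    LinearMap.proj ((chartAt ℂⁿ x₀).symm z)

/-- The length of the frame of `L` given by the preferred trivialization at `x₀`, as a function
on `ℂⁿ` in the preferred chart at `x₀`. -/
def frameNorm (h : HermitianMetric n L) (x₀ : X) (z : ℂⁿ) : ℝ :=
  h.norm ((chartAt ℂⁿ x₀).symm z) ((trivializationAt ℂ L x₀).symm ((chartAt ℂⁿ x₀).symm z) 1)

variable {x₀ : X} {z : EuclideanSpace ℂ (Fin n)}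

lemma coord_apply (hz : z ∈ coordDomain n L x₀) (s : ∀ x, L x) :
    coord n L x₀ s z = (trivializationAt ℂ L x₀
      ⟨(chartAt ℂⁿ x₀).symm z, s ((chartAt ℂⁿ x₀).symm z)⟩).2 :=
  congrFun (Trivialization.coe_linearMapAt_of_mem _ hz.2) _

lemma eq_coord_smul (hz : z ∈ coordDomain n L x₀) (s : ∀ x, L x) :
    s ((chartAt ℂⁿ x₀).symm z) =
      coord n L x₀ s z • (trivializationAt ℂ L x₀).symm ((chartAt ℂⁿ x₀).symm z) 1 := by
  rw [← Trivialization.coe_symmₗ (R := ℂ) _ hz.2, ← map_smul, smul_eq_mul, mul_one]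
  exact ((trivializationAt ℂ L x₀).symmₗ_linearMapAt hz.2 _).symm

lemma norm_eq_norm_coord_mul (h : HermitianMetric n L) (hz : z ∈ coordDomain n L x₀)
    (s : ∀ x, L x) :
    h.norm _ (s ((chartAt ℂⁿ x₀).symm z)) = ‖coord n L x₀ s z‖ * frameNorm h x₀ z := by
  rw [eq_coord_smul hz s, h.norm_smul, frameNorm]

lemma frameNorm_pos (h : HermitianMetric n L) (hz : z ∈ coordDomain n L x₀) :
    0 < frameNorm h x₀ z := by
  refine Real.sqrt_pos.2 (h.positive _ _ fun h0 => one_ne_zero (α := ℂ) ?_)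
  have h1 := (trivializationAt ℂ L x₀).linearMapAt_symmₗ (R := ℂ) hz.2 (1 : ℂ)
  rw [Trivialization.coe_symmₗ _ hz.2, h0, map_zero] at h1
  exact h1.symm

lemma continuousOn_frameNorm (h : HermitianMetric n L) (x₀ : X) :
    ContinuousOn (frameNorm h x₀) (coordDomain n L x₀) :=
  ((h.smooth (trivializationAt ℂ L x₀)).continuousOn.comp
    ((chartAt ℂⁿ x₀).continuousOn_symm.mono inter_subset_left) fun _ hz => hz.2).sqrt

section Holomorphic

variable [IsManifold 𝓘(ℂ, EuclideanSpace ℂ (Fin n)) ω X]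
  [ContMDiffVectorBundle ω ℂ L 𝓘(ℂ, EuclideanSpace ℂ (Fin n))]

lemma differentiableOn_coord {h : HermitianMetric n L} (s : HolSection h) (x₀ : X) :
    DifferentiableOn ℂ (coord n L x₀ s) (coordDomain n L x₀) := by
  have : IsManifold 𝓘(ℂ, ℂⁿ) 1 X := .of_le (n := ω) le_top
  have : ContMDiffVectorBundle 1 ℂ L 𝓘(ℂ, ℂⁿ) := .of_le (n := ω) le_top
  refine DifferentiableOn.congr (fun z hz => ?_) fun z hz => coord_apply hz _
  have hs := ((trivializationAt ℂ L x₀).mdifferentiableAt_section_iff 𝓘(ℂ, ℂⁿ)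
    s.toSection hz.2).1 (s.2 _)
  have hφ : MDifferentiableAt 𝓘(ℂ, ℂⁿ) 𝓘(ℂ, ℂⁿ) (chartAt ℂⁿ x₀).symm z :=
    mdifferentiableAt_atlas_symm (chart_mem_atlas _ x₀) hz.1
  exact (hs.comp z hφ).differentiableAt.differentiableWithinAt

lemma mdifferentiableAt_of_differentiableAt_coord {s : ∀ x, L x} (hz : z ∈ coordDomain n L x₀)
    (hs : DifferentiableAt ℂ (coord n L x₀ s) z) :
    MDifferentiableAt 𝓘(ℂ, ℂⁿ) (𝓘(ℂ, ℂⁿ).prod 𝓘(ℂ, ℂ)) (fun x => TotalSpace.mk' ℂ x (s x))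
      ((chartAt ℂⁿ x₀).symm z) := by
  have : IsManifold 𝓘(ℂ, ℂⁿ) 1 X := .of_le (n := ω) le_top
  have : ContMDiffVectorBundle 1 ℂ L 𝓘(ℂ, ℂⁿ) := .of_le (n := ω) le_top
  set φ := chartAt ℂⁿ x₀
  have hx : φ.symm z ∈ φ.source := φ.map_target hz.1
  have hφ : MDifferentiableAt 𝓘(ℂ, ℂⁿ) 𝓘(ℂ, ℂⁿ) φ (φ.symm z) :=
    mdifferentiableAt_atlas (chart_mem_atlas _ x₀) hx
  rw [← φ.right_inv hz.1] at hs
  refine ((trivializationAt ℂ L x₀).mdifferentiableAt_section_iff 𝓘(ℂ, ℂⁿ) s hz.2).2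
    ((hs.mdifferentiableAt.comp _ hφ).congr_of_eventuallyEq ?_)
  filter_upwards [φ.open_source.mem_nhds hx,
    (trivializationAt ℂ L x₀).open_baseSet.mem_nhds hz.2] with x hx hxL
  have hxz : φ x ∈ coordDomain n L x₀ :=
    ⟨φ.map_source hx, by rwa [mem_preimage, φ.left_inv hx]⟩
  rw [Function.comp_apply, coord_apply hxz, φ.left_inv hx]

end Holomorphic

lemma CoordPatch.exists_setLIntegral_enorm_coord_sq_le [IsManifold 𝓘(ℂ, ℂⁿ) ω X]
    [MeasurableSpace X] [BorelSpace X] [SecondCountableTopology X] (p : CoordPatch n L)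
    (Θ : HermitianForm n X) (h : HermitianMetric n L) :
    ∃ M : NNReal, ∀ s : ∀ x, L x, Measurable (fun x => h.norm x (s x)) →
      ∫⁻ z in p.compacts, ‖coord n L p.center s z‖ₑ ^ 2 ≤
        M * ∫⁻ x, ENNReal.ofReal (h.norm x (s x)) ^ 2 ∂Θ.vol := by
  set φ := chartAt ℂⁿ p.center
  have hφ : φ ∈ atlas ℂⁿ X := chart_mem_atlas _ _
  have hpφ : (p.compacts : Set ℂⁿ) ⊆ φ.target := fun z hz => (p.subset_coordDomain hz).1
  obtain ⟨a, ha, hpa⟩ := p.compacts.isCompact.exists_forall_le'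
    ((continuousOn_frameNorm h p.center).mono p.subset_coordDomain)
    fun z hz => frameNorm_pos h (p.subset_coordDomain hz)
  obtain ⟨c, hc, hpc⟩ := p.compacts.isCompact.exists_forall_le'
    ((Θ.continuousOn_volDensity hφ).mono hpφ) fun z hz => Θ.volDensity_pos hφ (hpφ hz)
  have hca : 0 < c * a ^ 2 := by positivity
  refine ⟨(c * a ^ 2).toNNReal⁻¹, fun s hs => ?_⟩
  rw [ENNReal.coe_inv (Real.toNNReal_pos.2 hca).ne', ← ENNReal.ofReal,
    ← ENNReal.mul_le_iff_le_inv (ENNReal.ofReal_pos.2 hca).ne' ENNReal.ofReal_ne_top]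
  calc ENNReal.ofReal (c * a ^ 2) * ∫⁻ z in p.compacts, ‖coord n L p.center s z‖ₑ ^ 2
    _ = ∫⁻ z in p.compacts, ENNReal.ofReal (c * a ^ 2) * ‖coord n L p.center s z‖ₑ ^ 2 :=
        (lintegral_const_mul' _ _ ENNReal.ofReal_ne_top).symm
    _ ≤ ∫⁻ z in p.compacts, ENNReal.ofReal (Θ.volDensity φ z) *
          ENNReal.ofReal (h.norm _ (s (φ.symm z))) ^ 2 := by
        refine setLIntegral_mono' p.compacts.isCompact.measurableSet fun z hz => ?_
        rw [norm_eq_norm_coord_mul h (p.subset_coordDomain hz), ENNReal.ofReal_mul hc.le,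
          ENNReal.ofReal_mul (norm_nonneg _), ofReal_norm, ENNReal.ofReal_pow ha.le, mul_pow,
          mul_assoc, mul_comm (‖_‖ₑ ^ 2)]
        gcongr
        exacts [hpc z hz, hpa z hz]
    _ ≤ ∫⁻ z in φ.target, ENNReal.ofReal (Θ.volDensity φ z) *
          ENNReal.ofReal (h.norm _ (s (φ.symm z))) ^ 2 := lintegral_mono_set hpφ
    _ = ∫⁻ x in φ.source, ENNReal.ofReal (h.norm x (s x)) ^ 2 ∂Θ.vol :=
        (Θ.setLIntegral_chart_source hφ (hs.ennreal_ofReal.pow_const 2)).symm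
    _ ≤ ∫⁻ x, ENNReal.ofReal (h.norm x (s x)) ^ 2 ∂Θ.vol := setLIntegral_le_lintegral _ _

end Coordinates

/-! ### The topology of `H⁰(X, L)` -/

namespace HolSection

variable {n : ℕ} {X : Type*} [TopologicalSpace X] [ChartedSpace (EuclideanSpace ℂ (Fin n)) X]
  {L : X → Type*} [TopologicalSpace (TotalSpace ℂ L)]
  [∀ x, AddCommGroup (L x)] [∀ x, Module ℂ (L x)] [∀ x, TopologicalSpace (L x)]
  [FiberBundle ℂ L] [VectorBundle ℂ ℂ L]
  [ContMDiffVectorBundle ω ℂ L 𝓘(ℂ, EuclideanSpace ℂ (Fin n))] {h : HermitianMetric n L}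

instance : IsTopologicalAddGroup (HolSection h) := withSeminorms.topologicalAddGroup

instance : ContinuousSMul ℂ (HolSection h) := withSeminorms.continuousSMul

lemma convergesLocallyUniformly_iff_tendsto {F : ℕ → HolSection h} {s : HolSection h} :
    ConvergesLocallyUniformly F s ↔ Tendsto F atTop (𝓝 s) := by
  rw [withSeminorms.tendsto_nhds]
  constructor
  · intro H K ε hε
    filter_upwards [H K K.isCompact (ε / 2) (by positivity)] with N hN
    exact (Real.iSup_le (fun x : K => (hN x x.2).le) (by positivity)).trans_lt (half_lt_self hε)
  · intro H K hK ε hε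
    filter_upwards [H ⟨K, hK⟩ ε hε] with N hN x hx
    exact (le_ciSup ((F N - s).bddAbove_norm ⟨K, hK⟩) ⟨x, hx⟩).trans_lt hN

end HolSection

section Restriction

variable {n : ℕ} {X : Type*} [TopologicalSpace X] [ChartedSpace (EuclideanSpace ℂ (Fin n)) X]
  {L : X → Type*} [TopologicalSpace (TotalSpace ℂ L)]
  [∀ x, AddCommGroup (L x)] [∀ x, Module ℂ (L x)] [∀ x, TopologicalSpace (L x)]
  [FiberBundle ℂ L] [VectorBundle ℂ ℂ L]

local notation "ℂⁿ" => EuclideanSpace ℂ (Fin n)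

lemma exists_coord_eq {x₀ : X} {z : ℂⁿ} (hz : z ∈ coordDomain n L x₀) (c : ℂ) :
    ∃ s : ∀ x, L x, coord n L x₀ s z = c := by
  refine ⟨fun x => (trivializationAt ℂ L x₀).symm x c, ?_⟩
  rw [coord_apply hz, (trivializationAt ℂ L x₀).apply_mk_symm hz.2]

lemma tendsto_coord_iff (h : HermitianMetric n L) {x₀ : X} {z : ℂⁿ}
    (hz : z ∈ coordDomain n L x₀) {ι : Type*} {l : Filter ι} {F : ι → ∀ x, L x} {s : ∀ x, L x} :
    Tendsto (fun i => coord n L x₀ (F i) z) l (𝓝 (coord n L x₀ s z)) ↔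
      Tendsto (fun i => h.norm _ (F i ((chartAt ℂⁿ x₀).symm z) - s ((chartAt ℂⁿ x₀).symm z))) l
        (𝓝 0) := by
  have hnorm : ∀ i, h.norm _ (F i ((chartAt ℂⁿ x₀).symm z) - s ((chartAt ℂⁿ x₀).symm z)) =
      ‖coord n L x₀ (F i) z - coord n L x₀ s z‖ * frameNorm h x₀ z := fun i => by
    rw [← Pi.sub_apply (coord n L x₀ (F i)), ← map_sub]
    exact norm_eq_norm_coord_mul h hz (F i - s)
  rw [tendsto_iff_norm_sub_tendsto_zero]
  simp only [hnorm]
  refine ⟨fun H => by simpa using H.mul_const (frameNorm h x₀ z), fun H => ?_⟩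
  simpa [(frameNorm_pos h hz).ne'] using H.div_const (frameNorm h x₀ z)

variable [IsManifold 𝓘(ℂ, EuclideanSpace ℂ (Fin n)) ω X]
  [ContMDiffVectorBundle ω ℂ L 𝓘(ℂ, EuclideanSpace ℂ (Fin n))]

lemma mdifferentiable_of_tendstoUniformlyOn_coord {t : Set (CoordPatch n L)}
    (ht : ∀ x, ∃ p ∈ t, x ∈ p.nhd) {h : HermitianMetric n L} {F : ℕ → HolSection h}
    {s : ∀ x, L x} (hF : ∀ p ∈ t, TendstoUniformlyOn (fun N => coord n L p.center (F N))
      (coord n L p.center s) atTop p.compacts) :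
    MDifferentiable 𝓘(ℂ, ℂⁿ) (𝓘(ℂ, ℂⁿ).prod 𝓘(ℂ, ℂ)) fun x => TotalSpace.mk' ℂ x (s x) := by
  intro x
  obtain ⟨p, hp, hxp⟩ := ht x
  have hd : DifferentiableOn ℂ (coord n L p.center s) (interior p.compacts) :=
    differentiableOn_of_tendstoLocallyUniformlyOn isOpen_interior
      (fun N => (differentiableOn_coord (F N) p.center).mono
        (interior_subset.trans p.subset_coordDomain))
      ((hF p hp).mono interior_subset).tendstoLocallyUniformlyOn
  rw [← (chartAt ℂⁿ p.center).left_inv hxp.1]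
  exact mdifferentiableAt_of_differentiableAt_coord (p.subset_coordDomain (interior_subset hxp.2))
    (hd.differentiableAt (isOpen_interior.mem_nhds hxp.2))

namespace CoordPatch

variable (p : CoordPatch n L) (h : HermitianMetric n L)

/-- The coordinate expression of holomorphic sections on a compact set, as a linear map. -/
def restrictₗ : HolSection h →ₗ[ℂ] C(p.compacts, ℂ) where
  toFun s := ⟨fun z => coord n L p.center s z, continuousOn_iff_continuous_domRestrict.1
    ((differentiableOn_coord s p.center).continuousOn.mono p.subset_coordDomain)⟩
  map_add' s t := by
    ext z
    exact congrFun (map_add (coord n L p.center) s.toSection t.toSection) z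
  map_smul' c s := by
    ext z
    exact congrFun (map_smul (coord n L p.center) c s.toSection) z

lemma exists_norm_restrictₗ_le_mul_supSeminorm :
    ∃ (C : NNReal) (K : TopologicalSpace.Compacts X), ∀ s : HolSection h,
      ‖p.restrictₗ h s‖ ≤ C * HolSection.supSeminorm h K s := by
  obtain ⟨a, ha, hpa⟩ := p.compacts.isCompact.exists_forall_le'
    ((continuousOn_frameNorm h p.center).mono p.subset_coordDomain)
    fun z hz => frameNorm_pos h (p.subset_coordDomain hz)
  let K : TopologicalSpace.Compacts X := ⟨_, p.isCompact_image_symm⟩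
  refine ⟨⟨a, ha.le⟩⁻¹, K, fun s => (ContinuousMap.norm_le _ (by positivity)).2 fun z => ?_⟩
  refine (le_inv_mul_iff₀ ha).2 ?_
  calc a * ‖coord n L p.center s z‖ ≤ ‖coord n L p.center s z‖ * frameNorm h p.center z := by
        rw [mul_comm]
        gcongr
        exact hpa z z.2
    _ = h.norm _ (s ((chartAt ℂⁿ p.center).symm z)) :=
        (norm_eq_norm_coord_mul h (p.subset_coordDomain z.2) s).symm
    _ ≤ HolSection.supSeminorm h K s := le_ciSup (s.bddAbove_norm K) ⟨_, mem_image_of_mem _ z.2⟩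

lemma continuous_restrictₗ : Continuous (p.restrictₗ h) := by
  obtain ⟨C, K, hCK⟩ := p.exists_norm_restrictₗ_le_mul_supSeminorm h
  refine HolSection.withSeminorms.continuous_normedSpace_rng _ _ ⟨{K}, C, fun s => ?_⟩
  rw [Finset.sup_singleton]
  exact hCK s

/-- The coordinate expression of holomorphic sections on a compact set, as a continuous linear
map. -/
def restrict : HolSection h →L[ℂ] C(p.compacts, ℂ) :=
  ⟨p.restrictₗ h, p.continuous_restrictₗ h⟩

lemma restrict_apply (s : HolSection h) (z : p.compacts) :
    p.restrict h s z = coord n L p.center s z := rfl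

lemma exists_norm_le_mul_norm_restrict :
    ∃ A : NNReal, ∀ s : HolSection h, ∀ x ∈ p.nhd, h.norm x (s x) ≤ A * ‖p.restrict h s‖ := by
  obtain ⟨A, hA⟩ := p.compacts.isCompact.bddAbove_image
    ((continuousOn_frameNorm h p.center).mono p.subset_coordDomain)
  refine ⟨A.toNNReal, fun s x hx => ?_⟩
  have hxp : chartAt ℂⁿ p.center x ∈ p.compacts := interior_subset hx.2
  have hnorm := norm_eq_norm_coord_mul h (p.subset_coordDomain hxp) s
  rw [OpenPartialHomeomorph.left_inv _ hx.1] at hnorm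
  rw [hnorm, mul_comm]
  gcongr
  · exact (hA (mem_image_of_mem _ hxp)).trans (Real.le_coe_toNNReal A)
  · exact (p.restrict h s).norm_coe_le_norm ⟨_, hxp⟩

end CoordPatch

variable {t : Set (CoordPatch n L)} {h : HermitianMetric n L}

lemma exists_supSeminorm_le_sum_norm_restrict (ht : ∀ x, ∃ p ∈ t, x ∈ p.nhd)
    (K : TopologicalSpace.Compacts X) :
    ∃ (F : Finset t) (A : t → NNReal), ∀ s : HolSection h,
      HolSection.supSeminorm h K s ≤ ∑ p ∈ F, A p * ‖p.1.restrict h s‖ := by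
  choose A hA using fun p : t => p.1.exists_norm_le_mul_norm_restrict h
  obtain ⟨F, hF⟩ := K.isCompact.elim_finite_subcover (fun p : t => p.1.nhd)
    (fun p => p.1.isOpen_nhd) fun x _ => by simpa using ht x
  have hnonneg : ∀ s : HolSection h, ∀ p ∈ F, 0 ≤ A p * ‖p.1.restrict h s‖ :=
    fun _ _ _ => by positivity
  refine ⟨F, A, fun s => Real.iSup_le (fun x => ?_) (Finset.sum_nonneg (hnonneg s))⟩
  obtain ⟨p, hp, hxp⟩ := mem_iUnion₂.1 (hF x.2)
  exact (hA p s x hxp).trans (Finset.single_le_sum (hnonneg s) hp)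

theorem isInducing_restrict (ht : ∀ x, ∃ p ∈ t, x ∈ p.nhd) :
    Topology.IsInducing fun (s : HolSection h) (p : t) => p.1.restrict h s := by
  refine Topology.isInducing_iff_nhds.2 fun s => le_antisymm
    (continuous_pi fun p : t => (p.1.restrict h).continuous).continuousAt.le_comap ?_
  refine tendsto_id'.1 ((HolSection.withSeminorms.tendsto_nhds _ _).2 fun K ε hε => ?_)
  obtain ⟨F, A, hFA⟩ := exists_supSeminorm_le_sum_norm_restrict ht (h := h) K
  have hlim : Tendsto (fun s' : HolSection h => ∑ p ∈ F, A p * ‖p.1.restrict h (s' - s)‖)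
      (comap (fun (s : HolSection h) (p : t) => p.1.restrict h s)
        (𝓝 fun p : t => p.1.restrict h s)) (𝓝 (∑ p ∈ F, A p * 0)) := by
    refine tendsto_finsetSum _ fun p _ => Tendsto.const_mul _ ?_
    simp only [map_sub]
    have hR := tendsto_comap (f := fun (s : HolSection h) (p : t) => p.1.restrict h s)
      (x := 𝓝 fun p : t => p.1.restrict h s)
    exact tendsto_iff_norm_sub_tendsto_zero.1 (tendsto_pi_nhds.1 hR p)
  simp only [mul_zero, Finset.sum_const_zero] at hlim
  filter_upwards [hlim.eventually_lt_const hε] with s' hs'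
  exact (hFA (s' - s)).trans_lt hs'

theorem exists_tendsto_of_cauchySeq_restrict (ht : ∀ x, ∃ p ∈ t, x ∈ p.nhd)
    {F : ℕ → HolSection h} (hF : ∀ p ∈ t, CauchySeq fun N => p.restrict h (F N)) :
    ∃ s, Tendsto F atTop (𝓝 s) := by
  choose! f hf using fun p (hp : p ∈ t) => cauchySeq_tendsto_of_complete (hF p hp)
  have hpt : ∀ p ∈ t, ∀ z : p.compacts,
      Tendsto (fun N => coord n L p.center (F N) z) atTop (𝓝 (f p z)) := fun p hp z =>
    ((continuous_eval_const z).tendsto _).comp (hf p hp)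
  have hfibre : ∀ x, ∃ v : L x, Tendsto (fun N => h.norm x (F N x - v)) atTop (𝓝 0) := by
    intro x
    obtain ⟨p, hp, hxp⟩ := ht x
    have hz := p.subset_coordDomain (interior_subset hxp.2)
    obtain ⟨s, hs⟩ := exists_coord_eq hz (f p ⟨_, interior_subset hxp.2⟩)
    have hFs := (tendsto_coord_iff h hz).1 (hs ▸ hpt p hp ⟨_, interior_subset hxp.2⟩)
    rw [(chartAt ℂⁿ p.center).left_inv hxp.1] at hFs
    exact ⟨s x, hFs⟩
  choose σ hσ using hfibre
  have hfσ : ∀ p ∈ t, ∀ z : p.compacts, f p z = coord n L p.center σ z := fun p hp z =>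
    tendsto_nhds_unique (hpt p hp z)
      ((tendsto_coord_iff h (p.subset_coordDomain z.2)).2 (hσ _))
  have hunif : ∀ p ∈ t, TendstoUniformlyOn (fun N => coord n L p.center (F N))
      (coord n L p.center σ) atTop p.compacts := by
    intro p hp
    rw [tendstoUniformlyOn_iff_tendstoUniformly_comp_coe]
    have := ContinuousMap.tendsto_iff_tendstoUniformly.1 (hf p hp)
    rwa [show ⇑(f p) = coord n L p.center σ ∘ (↑) from funext (hfσ p hp)] at this
  let s : HolSection h := ⟨σ, mdifferentiable_of_tendstoUniformlyOn_coord ht hunif⟩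
  refine ⟨s, (isInducing_restrict ht).tendsto_nhds_iff.2 (tendsto_pi_nhds.2 fun p => ?_)⟩
  rw [show p.1.restrict h s = f p from ContinuousMap.ext fun z => (hfσ p p.2 z).symm]
  exact hf p p.2

lemma HolSection.pseudoMetrizableSpace [SecondCountableTopology X] :
    TopologicalSpace.PseudoMetrizableSpace (HolSection h) := by
  obtain ⟨t, htc, ht⟩ := CoordPatch.exists_countable_cover n L
  have : Countable t := htc
  exact (isInducing_restrict ht).pseudoMetrizableSpace

end Restriction

/-! ### Square integrable sections -/

section SquareIntegrable

variable {n : ℕ} {X : Type*} [TopologicalSpace X] [ChartedSpace (EuclideanSpace ℂ (Fin n)) X]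
  {L : X → Type*} [TopologicalSpace (TotalSpace ℂ L)]
  [∀ x, AddCommGroup (L x)] [∀ x, Module ℂ (L x)] [∀ x, TopologicalSpace (L x)]
  [FiberBundle ℂ L] [VectorBundle ℂ ℂ L]
  [ContMDiffVectorBundle ω ℂ L 𝓘(ℂ, EuclideanSpace ℂ (Fin n))]

local notation "ℂⁿ" => EuclideanSpace ℂ (Fin n)

lemma L2HolSection.lintegral_norm_toHol_sq [MeasurableSpace X] [BorelSpace X]
    {Θ : HermitianForm n X} {h : HermitianMetric n L} (s : L2HolSection Θ h) :
    ∫⁻ x, ENNReal.ofReal (h.norm x (s.toHol x)) ^ 2 ∂Θ.vol = ‖s‖ₑ ^ 2 := by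
  have hs : Integrable (fun x => h.norm x (s.toHol x) ^ 2) Θ.vol := s.2
  have hre := integral_re (integrable_inner hs hs)
  simp only [← ENNReal.ofReal_pow (h.norm_nonneg _ _)]
  rw [← ofReal_integral_eq_lintegral_ofReal hs (.of_forall fun _ => sq_nonneg _), ← ofReal_norm,
    ← ENNReal.ofReal_pow (norm_nonneg s), @norm_sq_eq_re_inner ℂ]
  simp only [h.sq_norm]
  exact congrArg ENNReal.ofReal hre

namespace CoordPatch

variable [IsManifold 𝓘(ℂ, EuclideanSpace ℂ (Fin n)) ω X] (p : CoordPatch n L)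
  (h : HermitianMetric n L)

/-- Lebesgue measure on the compact set of a coordinate patch. -/
def vol : Measure p.compacts := volume.comap ((↑) : p.compacts → ℂⁿ)

instance : IsFiniteMeasure p.vol where
  measure_univ_lt_top :=
    (comap_subtype_coe_apply p.compacts.isCompact.measurableSet volume univ).trans_lt <|
      (measure_mono (Subtype.coe_image_subset _ _)).trans_lt p.compacts.isCompact.measure_lt_top

lemma enorm_toLp_restrict_sq (s : HolSection h) :
    ‖ContinuousMap.toLp 2 p.vol ℂ (p.restrict h s)‖ₑ ^ 2 =
      ∫⁻ z in p.compacts, ‖coord n L p.center s z‖ₑ ^ 2 := by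
  rw [enorm_toLp_sq]
  exact lintegral_subtype_comap p.compacts.isCompact.measurableSet
    fun z => ‖coord n L p.center s z‖ₑ ^ 2

lemma exists_norm_restrict_le_mul_norm_toLp_restrict :
    ∃ (q : CoordPatch n L) (C : NNReal), ∀ s : HolSection h,
      ‖p.restrict h s‖ ≤ C * ‖ContinuousMap.toLp 2 q.vol ℂ (q.restrict h s)‖ := by
  obtain ⟨q, hqp, hpq⟩ := p.exists_subset_interior
  obtain ⟨C, hC⟩ := exists_forall_enorm_sq_le_mul_setLIntegral (μ := volume) p.compacts.isCompact
    isOpen_interior hpq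
  refine ⟨q, NNReal.sqrt C, fun s => (ContinuousMap.norm_le _ (by positivity)).2 fun z =>
    norm_le_sqrt_mul_of_enorm_sq_le ?_⟩
  rw [enorm_toLp_restrict_sq, hqp, restrict_apply]
  refine (hC _ ((differentiableOn_coord s p.center).mono ?_) z z.2).trans ?_
  · rw [← hqp]
    exact interior_subset.trans q.subset_coordDomain
  · gcongr
    exact interior_subset

variable [MeasurableSpace X] [BorelSpace X] [SecondCountableTopology X] (Θ : HermitianForm n X)

lemma exists_norm_restrict_toHol_le :
    ∃ C : NNReal, ∀ s : L2HolSection Θ h, ‖p.restrict h s.toHol‖ ≤ C * ‖s‖ := by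
  obtain ⟨q, C, hC⟩ := p.exists_norm_restrict_le_mul_norm_toLp_restrict h
  obtain ⟨M, hM⟩ := q.exists_setLIntegral_enorm_coord_sq_le Θ h
  refine ⟨C * NNReal.sqrt M, fun s => (hC s.toHol).trans ?_⟩
  rw [NNReal.coe_mul, mul_assoc]
  gcongr
  refine norm_le_sqrt_mul_of_enorm_sq_le ?_
  rw [enorm_toLp_restrict_sq, ← s.lintegral_norm_toHol_sq]
  exact hM s.toHol s.toHol.continuous_norm.measurable

end CoordPatch

variable [IsManifold 𝓘(ℂ, EuclideanSpace ℂ (Fin n)) ω X]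
  [MeasurableSpace X] [BorelSpace X] [SecondCountableTopology X] (Θ : HermitianForm n X)
  (h : HermitianMetric n L)

/-- The inclusion of the square integrable holomorphic sections into `H⁰(X, L)`. -/
def L2HolSection.toHolCLM : L2HolSection Θ h →L[ℂ] HolSection h where
  toLinearMap := (l2Submodule Θ h).subtype
  cont := by
    obtain ⟨t, -, ht⟩ := CoordPatch.exists_countable_cover n L
    refine (isInducing_restrict ht).continuous_iff.2 (continuous_pi fun p => ?_)
    obtain ⟨C, hC⟩ := p.1.exists_norm_restrict_toHol_le h Θ
    let f : L2HolSection Θ h →ₗ[ℂ] C(p.1.compacts, ℂ) :=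
      p.1.restrictₗ h ∘ₗ (l2Submodule Θ h).subtype
    exact AddMonoidHomClass.continuous_of_bound f C hC

lemma L2HolSection.toHolCLM_apply (s : L2HolSection Θ h) : toHolCLM Θ h s = s.toHol := rfl

end SquareIntegrable

/-! ### Random sections -/

section RandomSections

variable {d : ℕ∞}

lemma tendsto_subtype_range : Tendsto
    (fun N => Finset.subtype (fun j : ℕ => (j : ℕ∞) < d) (Finset.range N)) atTop atTop := by
  refine tendsto_atTop_finset_of_monotone (fun N N' hN => ?_) fun j => ⟨j + 1, ?_⟩
  · exact Finset.subtype_mono (Finset.range_mono hN)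
  · simp

lemma IsIIDCenteredGaussian.exists_forall_integral_norm_sq_le {Ω ι : Type*} [MeasurableSpace Ω]
    {P : Measure Ω} {η : ι → Ω → ℂ} (hη : IsIIDCenteredGaussian η P) :
    ∃ σ : ℝ, ∀ j, ∫ w, ‖η j w‖ ^ 2 ∂P ≤ σ := by
  rcases isEmpty_or_nonempty ι with _ | ⟨⟨i⟩⟩
  · exact ⟨0, isEmptyElim⟩
  · exact ⟨∫ w, ‖η i w‖ ^ 2 ∂P, fun j => (((hη.identDistrib j i).comp (u := fun z : ℂ => ‖z‖ ^ 2)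
      (by fun_prop)).integral_eq).le⟩

variable {n : ℕ} {X : Type*} [TopologicalSpace X] [ChartedSpace (EuclideanSpace ℂ (Fin n)) X]
  [MeasurableSpace X] [BorelSpace X]
  {L : X → Type*} [TopologicalSpace (TotalSpace ℂ L)]
  [∀ x, AddCommGroup (L x)] [∀ x, Module ℂ (L x)] [∀ x, TopologicalSpace (L x)]
  [FiberBundle ℂ L] [VectorBundle ℂ ℂ L]
  [ContMDiffVectorBundle ω ℂ L 𝓘(ℂ, EuclideanSpace ℂ (Fin n))]
  {Θ : HermitianForm n X} {h : HermitianMetric n L} {S : BasisIndex d → L2HolSection Θ h}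

lemma partialSum_eq_sum_subtype (S : BasisIndex d → L2HolSection Θ h) (c : BasisIndex d → ℂ)
    (N : ℕ) : partialSum S c N =
      ∑ j ∈ Finset.subtype (fun j : ℕ => (j : ℕ∞) < d) (Finset.range N), c j • (S j).toHol := by
  let g : ℕ → HolSection h := fun j =>
    if hj : (j : ℕ∞) < d then c ⟨j, hj⟩ • (S ⟨j, hj⟩).toHol else 0
  have hg (j : BasisIndex d) : c j • (S j).toHol = g j := by
    simp only [g, dif_pos j.2]
  simp only [hg]
  rw [Finset.sum_subtype_eq_sum_filter, Finset.sum_filter_of_ne]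
  · rfl
  · intro j _ hj
    by_contra hjd
    exact hj (dif_neg hjd)

lemma tendsto_partialSum_of_natCast {m : ℕ} (S : BasisIndex m → L2HolSection Θ h)
    (c : BasisIndex m → ℂ) : Tendsto (partialSum S c) atTop (𝓝 (partialSum S c m)) := by
  refine tendsto_atTop_of_eventually_const fun N (hN : m ≤ N) =>
    (Finset.sum_subset (Finset.range_mono hN) fun j _ hj => dif_neg ?_).symm
  rwa [Nat.cast_lt, ← Finset.mem_range]

lemma partialSum_top_eq_sum (S : BasisIndex ⊤ → L2HolSection Θ h) (c : BasisIndex ⊤ → ℂ) (N : ℕ) :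
    partialSum S c N = ∑ j ∈ Finset.range N,
      c ⟨j, ENat.natCast_lt_top j⟩ • (S ⟨j, ENat.natCast_lt_top j⟩).toHol :=
  Finset.sum_congr rfl fun j _ => dif_pos (ENat.natCast_lt_top j)

variable [IsManifold 𝓘(ℂ, EuclideanSpace ℂ (Fin n)) ω X] [SecondCountableTopology X]
  {Ω : Type*} [MeasurableSpace Ω] {P : Measure Ω}
  {η : BasisIndex d → Ω → ℂ}

lemma IsGaussianSeries.ae_tendsto_sum_toHolCLM {ψ : Ω → HolSection h}
    (hψ : IsGaussianSeries P S η ψ) : ∀ᵐ w ∂P, Tendsto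
      (fun N => ∑ j ∈ Finset.subtype (fun j : ℕ => (j : ℕ∞) < d) (Finset.range N),
        η j w • L2HolSection.toHolCLM Θ h (S j)) atTop (𝓝 (ψ w)) :=
  hψ.mono fun _ hw => (HolSection.convergesLocallyUniformly_iff_tendsto.1 hw).congr
    (partialSum_eq_sum_subtype S _)

theorem IsGaussianSeries.identDistrib [IsFiniteMeasure P] {d' : ℕ∞}
    {S' : BasisIndex d' → L2HolSection Θ h} {Ω' : Type*} [MeasurableSpace Ω'] {P' : Measure Ω'}
    [IsFiniteMeasure P'] {η' : BasisIndex d' → Ω' → ℂ} {ψ : Ω → HolSection h}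
    {ψ' : Ω' → HolSection h} (hψ : IsGaussianSeries P S η ψ) (hψ' : IsGaussianSeries P' S' η' ψ')
    (hS : L2HolSection.IsOrthonormalBasis Θ h S) (hS' : L2HolSection.IsOrthonormalBasis Θ h S')
    (hη : IsIIDStdComplexGaussian η P) (hη' : IsIIDStdComplexGaussian η' P') :
    IdentDistrib ψ ψ' P P' := by
  obtain ⟨t, htc, ht⟩ := CoordPatch.exists_countable_cover n L
  have : Countable t := htc
  exact identDistrib_of_tendsto_sum_smul (isInducing_restrict ht)
    hS.orthonormal hS.dense hη tendsto_subtype_range hψ.ae_tendsto_sum_toHolCLM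
    hS'.orthonormal hS'.dense hη' tendsto_subtype_range hψ'.ae_tendsto_sum_toHolCLM

variable [IsProbabilityMeasure P] {σ : ℝ}

lemma ae_cauchySeq_restrict_partialSum {S : BasisIndex ⊤ → L2HolSection Θ h}
    {η : BasisIndex ⊤ → Ω → ℂ} (hS : Orthonormal ℂ S) (hL : ∀ j, MemLp (η j) 2 P)
    (h0 : ∀ j, ∫ w, η j w ∂P = 0) (hi : iIndepFun η P) (hσ : ∀ j, ∫ w, ‖η j w‖ ^ 2 ∂P ≤ σ)
    (p : CoordPatch n L) :
    ∀ᵐ w ∂P, CauchySeq fun N => p.restrict h (partialSum S (fun j => η j w) N) := by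
  let e : ℕ → BasisIndex ⊤ := fun j => ⟨j, ENat.natCast_lt_top j⟩
  have he : Function.Injective e := fun i j hij => congrArg Subtype.val hij
  obtain ⟨q, C, hC⟩ := p.exists_norm_restrict_le_mul_norm_toLp_restrict h
  filter_upwards [ae_cauchySeq_sum_range_smul_toLp (μ := q.vol) (hS.comp e he)
    ((q.restrict h).comp (L2HolSection.toHolCLM Θ h)) (fun j => hL (e j)) (fun j => h0 (e j))
    (hi.precomp he) (fun j => hσ (e j))] with w hw
  refine cauchySeq_of_dist_le_mul (C := C) (fun N N' => ?_) hw
  simp only [Function.comp_apply, ContinuousLinearMap.comp_apply, L2HolSection.toHolCLM_apply,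
    ← map_smul, ← map_sum]
  rw [partialSum_top_eq_sum, partialSum_top_eq_sum, dist_eq_norm, dist_eq_norm, ← map_sub,
    ← map_sub, ← map_sub]
  exact hC _

theorem ae_exists_tendsto_partialSum (hS : Orthonormal ℂ S) (hL : ∀ j, MemLp (η j) 2 P)
    (h0 : ∀ j, ∫ w, η j w ∂P = 0) (hi : iIndepFun η P) (hσ : ∀ j, ∫ w, ‖η j w‖ ^ 2 ∂P ≤ σ) :
    ∀ᵐ w ∂P, ∃ s, Tendsto (partialSum S fun j => η j w) atTop (𝓝 s) := by
  induction d using ENat.recTopCoe with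
  | coe m => exact .of_forall fun w => ⟨_, tendsto_partialSum_of_natCast S _⟩
  | top =>
    obtain ⟨t, htc, ht⟩ := CoordPatch.exists_countable_cover n L
    filter_upwards [(ae_ball_iff htc).2 fun p _ =>
      ae_cauchySeq_restrict_partialSum hS hL h0 hi hσ p] with w hw
    exact exists_tendsto_of_cauchySeq_restrict ht hw

theorem exists_measurable_isGaussianSeries (hS : Orthonormal ℂ S) (hL : ∀ j, MemLp (η j) 2 P)
    (h0 : ∀ j, ∫ w, η j w ∂P = 0) (hi : iIndepFun η P) (hσ : ∀ j, ∫ w, ‖η j w‖ ^ 2 ∂P ≤ σ) :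
    ∃ ψ : Ω → HolSection h, Measurable ψ ∧ IsGaussianSeries P S η ψ := by
  have := HolSection.pseudoMetrizableSpace (h := h)
  have hm (N : ℕ) : AEMeasurable (fun w => partialSum S (fun j => η j w) N) P := by
    simp only [partialSum_eq_sum_subtype]
    exact aemeasurable_sum_smul (fun j => (hL j).1.aemeasurable) _ _
  obtain ⟨ψ, hψm, hψ⟩ := measurable_limit_of_tendsto_metrizable_ae hm
    (ae_exists_tendsto_partialSum hS hL h0 hi hσ)
  exact ⟨ψ, hψm, hψ.mono fun w hw => HolSection.convergesLocallyUniformly_iff_tendsto.2 hw⟩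

end RandomSections

end GaussSec

end

theorem mainTheorem12_general {n : ℕ} {X : Type*} [TopologicalSpace X]
    [SecondCountableTopology X] [ChartedSpace (EuclideanSpace ℂ (Fin n)) X]
    [IsManifold 𝓘(ℂ, EuclideanSpace ℂ (Fin n)) ω X] [MeasurableSpace X] [BorelSpace X]
    {L : X → Type*} [TopologicalSpace (TotalSpace ℂ L)]
    [∀ x, AddCommGroup (L x)] [∀ x, Module ℂ (L x)] [∀ x, TopologicalSpace (L x)]
    [FiberBundle ℂ L] [VectorBundle ℂ ℂ L]
    [ContMDiffVectorBundle ω ℂ L 𝓘(ℂ, EuclideanSpace ℂ (Fin n))]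
    (Θ : GaussSec.HermitianForm n X) (h : GaussSec.HermitianMetric n L) (d : ℕ∞)
    {Ω : Type*} [MeasurableSpace Ω] (P : Measure Ω) [IsProbabilityMeasure P]
    {Ω' : Type*} [MeasurableSpace Ω'] (P' : Measure Ω') [IsProbabilityMeasure P'] :
    (∀ (S : GaussSec.BasisIndex d → GaussSec.L2HolSection Θ h)
        (η : GaussSec.BasisIndex d → Ω → ℂ) (σ : ℝ),
      Orthonormal ℂ S → (∀ j, MemLp (η j) 2 P) → (∀ j, ∫ w, η j w ∂P = 0) → iIndepFun η P →
      (∀ j, ∫ w, ‖η j w‖ ^ 2 ∂P ≤ σ) →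
      ∃ ψ : Ω → GaussSec.HolSection h, Measurable ψ ∧ GaussSec.IsGaussianSeries P S η ψ) ∧
    (∀ (S S' : GaussSec.BasisIndex d → GaussSec.L2HolSection Θ h)
        (η : GaussSec.BasisIndex d → Ω → ℂ) (η' : GaussSec.BasisIndex d → Ω' → ℂ)
        (ψ : Ω → GaussSec.HolSection h) (ψ' : Ω' → GaussSec.HolSection h),
      GaussSec.L2HolSection.IsOrthonormalBasis Θ h S →
      GaussSec.L2HolSection.IsOrthonormalBasis Θ h S' →
      GaussSec.IsIIDStdComplexGaussian η P →
      GaussSec.IsIIDStdComplexGaussian η' P' →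
      GaussSec.IsGaussianSeries P S η ψ →
      GaussSec.IsGaussianSeries P' S' η' ψ' →
      IdentDistrib ψ ψ' P P') :=
  ⟨fun _ _ _ hS hL h0 hi hσ => GaussSec.exists_measurable_isGaussianSeries hS hL h0 hi hσ,
    fun _ _ _ _ _ _ hS hS' hη hη' hψ hψ' => hψ.identDistrib hψ' hS hS' hη hη'⟩

theorem mainTheorem12 {n : ℕ} {X : Type*} [TopologicalSpace X] [T2Space X]
    [SecondCountableTopology X] [ConnectedSpace X]
    [ChartedSpace (EuclideanSpace ℂ (Fin n)) X]
    [IsManifold 𝓘(ℂ, EuclideanSpace ℂ (Fin n)) ω X]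
    [MeasurableSpace X] [BorelSpace X]
    {L : X → Type*} [TopologicalSpace (TotalSpace ℂ L)]
    [∀ x, AddCommGroup (L x)] [∀ x, Module ℂ (L x)] [∀ x, TopologicalSpace (L x)]
    [FiberBundle ℂ L] [VectorBundle ℂ ℂ L]
    [ContMDiffVectorBundle ω ℂ L 𝓘(ℂ, EuclideanSpace ℂ (Fin n))]
    (Θ : GaussSec.HermitianForm n X) (h : GaussSec.HermitianMetric n L) (d : ℕ∞)
    {Ω : Type*} [MeasurableSpace Ω] (P : Measure Ω) [IsProbabilityMeasure P]
    {Ω' : Type*} [MeasurableSpace Ω'] (P' : Measure Ω') [IsProbabilityMeasure P'] :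
    (∀ (S : GaussSec.BasisIndex d → GaussSec.L2HolSection Θ h)
        (η : GaussSec.BasisIndex d → Ω → ℂ),
      GaussSec.L2HolSection.IsOrthonormalBasis Θ h S →
      GaussSec.IsIIDCenteredGaussian η P →
      ∃ ψ : Ω → GaussSec.HolSection h, Measurable ψ ∧ GaussSec.IsGaussianSeries P S η ψ) ∧
    (∀ (S S' : GaussSec.BasisIndex d → GaussSec.L2HolSection Θ h)
        (η : GaussSec.BasisIndex d → Ω → ℂ) (η' : GaussSec.BasisIndex d → Ω' → ℂ)
        (ψ : Ω → GaussSec.HolSection h) (ψ' : Ω' → GaussSec.HolSection h),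
      GaussSec.L2HolSection.IsOrthonormalBasis Θ h S →
      GaussSec.L2HolSection.IsOrthonormalBasis Θ h S' →
      GaussSec.IsIIDStdComplexGaussian η P →
      GaussSec.IsIIDStdComplexGaussian η' P' →
      GaussSec.IsGaussianSeries P S η ψ →
      GaussSec.IsGaussianSeries P' S' η' ψ' →
      IdentDistrib ψ ψ' P P') := by
  obtain ⟨exists_series, identDistrib⟩ := mainTheorem12_general Θ h d P P'
  refine ⟨fun S η hS hη => ?_, identDistrib⟩
  obtain ⟨σ, hσ⟩ := hη.exists_forall_integral_norm_sq_le
  exact exists_series S η σ hS.orthonormal (fun j => (hη.gaussian j).memLp_two) hη.centered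
    hη.indep hσ
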